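/- **Definitions.** *Spectra.* For a positive semidefinite matrix $M$, $\gamma(M)$ denotes its smallest nonzero eigenvalue. *Bose–Hubbard model.* For a finite graph $G$ with adjacency matrix $A(G)$ (self-loops allowed), let $\mu(G)$ be the smallest eigenvalue of $A(G)$. On $(\mathbb C^{V(G)})^{\otimes N}$ put $$H_G^N=\sum_{i=1}^N A(G)^{(i)}+\sum_{k\in V(G)}\hat n_k(\hat n_k-1),\qquad \hat n_k=\sum_{i=1}^N |k\rangle\langle k|^{(i)},$$ where $M^{(i)}$ acts as $M$ on the $i$-th register and as the identity on the others. Let $\lambda_N^1(G)$ be the smallest eigenvalue of $H_G^N-N\mu(G)$ restricted to the subspace $\mathcal Z_N(G)$ of states symmetric under permutation of the $N$ registers. *The graph $g_0$.* It is the simple graph with the 128 vertices $(z,t,j)$, $z\in\{0,1\}$, $t\in\{1,\dots,8\}$, $j\in\{0,\dots,7\}$ ($t$ and $j$ modulo 8) and adjacency matrix $$A(g_0)=\sum_{t=1}^8\bigl(|t+1\rangle\langle t|\otimes B(U_t)+\text{h.c.}\bigr)+1_z\otimes1_t\otimes(S^3+S^4+S^5),$$ where $S|j\rangle=|j+1 \bmod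 8\rangle$, $(U_1,\dots,U_8)=(H,H,HT,(HT)^\dagger,HT,(HT)^\dagger,H,H)$ with $$H=\tfrac1{\sqrt2}\begin{pmatrix}1&1\\1&-1\end{pmatrix},\qquad T=\begin{pmatrix}1&0\\0&e^{i\pi/4}\end{pmatrix},$$ and $B(U)$, acting on the registers $z,j$, is obtained from $-\sqrt2\,U$ by replacing each entry $e^{i\pi k/4}$ by $S^k$. Its smallest eigenvalue is $e_1=-1-3\sqrt2$. *Gate graphs.* A gate diagram with $R$ diagram elements gives each $q\in[R]$ a label $1$, $H$ or $HT$; the nodes of element $q$ are $(q,z,t)$ with $z\in\{0,1\}$ and $t\in\{1,3,5,7\}$, $\{1,3,2,8\}$ or $\{1,3,4,6\}$, respectively. It consists further of a set $\mathcal S$ of nodes (self-loops) and a set $\mathcal E$ of pairs of distinct nodes (edges), such that no node lies in two edges, or in both an edge and $\mathcal S$. Its gate graph $G$ has vertices $(q,z,t,j)$, with $q\in[R]$ and $z,t,j$ as for $g_0$, and adjacency matrix $$A(G)=1_q\otimes A(g_0)+\sum_{n\in\mathcal S}|n\rangle\langle n|\otimes 1_j+\sum_{\{n,n'\}\in\mathcal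 E}(|n\rangle+|n'\rangle)(\langle n|+\langle n'|)\otimes 1_j .$$ $G$ is an *$e_1$-gate graph* if the smallest eigenvalue of $A(G)$ is $e_1$. *The graph $G^{\rm SL}$.* Let $\mathcal N$ be the set of vertices $(q,z,t,j)$ of $G$ such that $(q,z,t)$ is neither in $\mathcal S$ nor in an edge of $\mathcal E$, and let $\Pi_{\mathcal N}=\sum_{v\in\mathcal N}|v\rangle\langle v|$. $G^{\rm SL}$ has vertex set $V(G)\times\{0,1\}$ and adjacency matrix $$A(G^{\rm SL})=A(G)\otimes 1+2\,\Pi_{\mathcal N}\otimes\Pi_+,\qquad \Pi_+=\tfrac12(|0\rangle+|1\rangle)(\langle0|+\langle1|).$$ **Lemma.** (i) Let $G$ be an $e_1$-gate graph. For every $N$ and every real $a$, if $\lambda_N^1(G)\le a$, then $\lambda_N^1(G^{\rm SL})\le\frac32a$. (ii) There is an absolute constant $C_1>0$ such that, for every $e_1$-gate graph $G$ described by a gate diagram with $R$ diagram elements, every $N$ and all real $C_0$, $b$: if $\gamma(A(G)-e_1)\ge C_0/R^3$ and $\lambda_N^1(G)\ge b>0$, then $$\lambda_N^1(G^{\rm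 SL})\ge\frac{C_0C_1}{R^3N^2}\,b .$$ -/

import Mathlib

open scoped Kronecker

noncomputable section

namespace BoseHubbard

/-! ### Spectra -/

/-- The real eigenvalues of the restriction of the matrix `M` to the (invariant) subspace `Z`. -/
def eigenvaluesOn {ι : Type*} [Fintype ι] (M : Matrix ι ι ℂ) (Z : Submodule ℂ (ι → ℂ)) : Set ℝ :=
  {x | ∃ v ∈ Z, v ≠ 0 ∧ M.mulVec v = (x : ℂ) • v}

/-- The real eigenvalues of the matrix `M`. -/
def eigenvalues {ι : Type*} [Fintype ι] (M : Matrix ι ι ℂ) : Set ℝ :=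
  eigenvaluesOn M ⊤

/-- The smallest eigenvalue `μ` of an adjacency matrix. -/
def minEigenvalue {ι : Type*} [Fintype ι] (A : Matrix ι ι ℂ) : ℝ :=
  sInf (eigenvalues A)

/-- `γ(M)`: the smallest nonzero eigenvalue of a positive semidefinite matrix `M`. -/
def gap {ι : Type*} [Fintype ι] (M : Matrix ι ι ℂ) : ℝ :=
  sInf {x | x ∈ eigenvalues M ∧ x ≠ 0}

/-! ### The Bose-Hubbard model

A graph with vertex set `V` is given by its adjacency matrix `A : Matrix V V ℂ`. The space of `N`
distinguishable particles `(ℂ^V)^{⊗N}` is `(Fin N → V) → ℂ`; the basis state `|x₁ … x_N⟩` is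
`Pi.single x 1`. -/

section Model

variable {V : Type*} [Fintype V] [DecidableEq V]

/-- `M^{(i)}`: the operator `M` on the `i`-th register, the identity on all the others. -/
def onRegister (N : ℕ) (M : Matrix V V ℂ) (i : Fin N) : Matrix (Fin N → V) (Fin N → V) ℂ :=
  Matrix.of fun x y => if ∀ j, j ≠ i → x j = y j then M (x i) (y i) else 0

/-- The number operator `n̂_k = ∑ᵢ |k⟩⟨k|^{(i)}`. -/
def numberOp (N : ℕ) (k : V) : Matrix (Fin N → V) (Fin N → V) ℂ :=
  ∑ i : Fin N, onRegister N (Matrix.single k k (1 : ℂ)) i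

/-- `H_G^N = ∑ᵢ A(G)^{(i)} + ∑_k n̂_k (n̂_k - 1)` on the distinguishable-particle space. -/
def hamiltonian (N : ℕ) (A : Matrix V V ℂ) : Matrix (Fin N → V) (Fin N → V) ℂ :=
  ∑ i : Fin N, onRegister N A i + ∑ k : V, numberOp N k * (numberOp N k - 1)

/-- `Sym(|x₁ … x_N⟩) = (N!)^{-1/2} ∑_π |x_{π(1)} … x_{π(N)}⟩`. -/
def symState (N : ℕ) (x : Fin N → V) : (Fin N → V) → ℂ :=
  ((1 / Real.sqrt (N.factorial : ℝ) : ℝ) : ℂ) •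
    ∑ p : Equiv.Perm (Fin N), Pi.single (x ∘ p) (1 : ℂ)

variable (V) in
/-- The bosonic space `Z_N(G)`. -/
def bosonicSpace (N : ℕ) : Submodule ℂ ((Fin N → V) → ℂ) :=
  Submodule.span ℂ (Set.range (symState (V := V) N))

/-- `λ_N^1(G)`: the smallest eigenvalue of `H(G,N) = H_G^N - N μ(G)` restricted to `Z_N(G)`. -/
def groundEnergy (N : ℕ) (A : Matrix V V ℂ) : ℝ :=
  sInf (eigenvaluesOn (hamiltonian N A - (((N : ℝ) * minEigenvalue A : ℝ) : ℂ) • 1)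
    (bosonicSpace V N))

end Model

/-! ### The graph `g₀`

Vertices are triples `(z, t, j)`. Both `t ∈ {1, …, 8}` and `j ∈ {0, …, 7}` are taken modulo `8`
(so `t = 8` is `0`). With `ω = exp(iπ/4)`, the entries of `-√2 H`, `-√2 HT`, `-√2 (HT)†` are powers
of `ω`; the tables below list the exponents. Around the cycle `t = 1 → 2 → ⋯ → 8 → 1` the gates
`H, H, HT, (HT)†, HT, (HT)†, H, H` are applied, each `ω^k` becomes the shift `j ↦ j + k` on the
last register, and finally the shifts by `3, 4, 5` on the last register are added:
`A(g₀) = ∑ₜ (|t+1⟩⟨t| ⊗ B(Uₜ) + h.c.) + 1 ⊗ 1 ⊗ (S³ + S⁴ + S⁵)`. -/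

abbrev G0Vertex : Type := Fin 2 × ZMod 8 × ZMod 8

def expH : Matrix (Fin 2) (Fin 2) (ZMod 8) := !![4, 4; 4, 0]
def expHT : Matrix (Fin 2) (Fin 2) (ZMod 8) := !![4, 5; 4, 1]
def expHTdag : Matrix (Fin 2) (Fin 2) (ZMod 8) := !![4, 4; 3, 7]

/-- Exponents of the gate applied between times `t` and `t + 1`. -/
def gateExp (t : ZMod 8) : Matrix (Fin 2) (Fin 2) (ZMod 8) :=
  if t = 3 ∨ t = 5 then expHT else if t = 4 ∨ t = 6 then expHTdag else expH

/-- A step forward in time, from `v` to `w`. -/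
def G0Step (v w : G0Vertex) : Prop :=
  w.2.1 = v.2.1 + 1 ∧ w.2.2 = v.2.2 + gateExp v.2.1 w.1 v.1

/-- A shift of the last register by `3`, `4` or `5`. -/
def G0Shift (v w : G0Vertex) : Prop :=
  w.1 = v.1 ∧ w.2.1 = v.2.1 ∧
    (w.2.2 = v.2.2 + 3 ∨ w.2.2 = v.2.2 + 4 ∨ w.2.2 = v.2.2 + 5)

theorem add_const_symm (a b : ZMod 8) (h : b = a + 3 ∨ b = a + 4 ∨ b = a + 5) :
    a = b + 3 ∨ a = b + 4 ∨ a = b + 5 := by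
  revert a b; decide

theorem ne_add_const (a : ZMod 8) : a ≠ a + 1 ∧ a ≠ a + 3 ∧ a ≠ a + 4 ∧ a ≠ a + 5 := by
  revert a; decide

/-- The simple 128-vertex graph `g₀`. -/
def g0 : SimpleGraph G0Vertex where
  Adj v w := G0Step v w ∨ G0Step w v ∨ G0Shift v w
  symm := ⟨by
    rintro v w (h | h | ⟨h1, h2, h3⟩)
    · exact Or.inr (Or.inl h)
    · exact Or.inl h
    · exact Or.inr (Or.inr ⟨h1.symm, h2.symm, add_const_symm _ _ h3⟩)⟩
  loopless := ⟨by
    rintro v (h | h | ⟨_, _, h | h | h⟩)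
    · exact (ne_add_const _).1 h.1
    · exact (ne_add_const _).1 h.1
    · exact (ne_add_const _).2.1 h
    · exact (ne_add_const _).2.2.1 h
    · exact (ne_add_const _).2.2.2 h⟩

open Classical in
/-- `A(g₀)`. -/
def adjG0 : Matrix G0Vertex G0Vertex ℂ := g0.adjMatrix ℂ

/-- `e₁ = -1 - 3√2`, the smallest eigenvalue of `A(g₀)`. -/
def e1 : ℝ := -1 - 3 * Real.sqrt 2

/-! ### Gate diagrams and gate graphs -/

/-- The unitary label of a diagram element: `1`, `H` or `HT`. -/
inductive UnitaryLabel where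
  | one
  | H
  | HT

/-- The values `t` such that the nodes `(0, t)`, `(1, t)` appear in a diagram element. -/
def UnitaryLabel.times : UnitaryLabel → Set (ZMod 8)
  | .one => {1, 3, 5, 7}
  | .H => {1, 3, 2, 8}
  | .HT => {1, 3, 4, 6}

/-- Labels `(q, z, t)` of nodes. -/
abbrev Node (R : ℕ) : Type := Fin R × Fin 2 × ZMod 8

/-- A gate diagram with `R` diagram elements: self-loops and edges are attached to nodes that appear
in the diagram elements, and no node has more than one self-loop or edge. -/
structure GateDiagram (R : ℕ) where
  label : Fin R → UnitaryLabel
  loops : Finset (Node R)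
  edges : Finset (Sym2 (Node R))
  loops_appear : ∀ n ∈ loops, n.2.2 ∈ (label n.1).times
  edges_appear : ∀ e ∈ edges, ∀ n ∈ e, n.2.2 ∈ (label n.1).times
  edges_not_diag : ∀ e ∈ edges, ¬ e.IsDiag
  loop_not_edge : ∀ n ∈ loops, ∀ e ∈ edges, n ∉ e
  edge_unique : ∀ e ∈ edges, ∀ e' ∈ edges, ∀ n, n ∈ e → n ∈ e' → e = e'

/-- Vertices `(q, z, t, j)` of a gate graph. -/
abbrev Vertex (R : ℕ) : Type := Fin R × G0Vertex

/-- The node `(q, z, t)` of a vertex `(q, z, t, j)`. -/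
def Vertex.node {R : ℕ} (v : Vertex R) : Node R := (v.1, v.2.1, v.2.2.1)

namespace GateDiagram

variable {R : ℕ} (D : GateDiagram R)

open Classical in
/-- `h_S = ∑_{n ∈ S} |n⟩⟨n| ⊗ 1_j`. -/
def hS : Matrix (Vertex R) (Vertex R) ℂ :=
  Matrix.diagonal fun v => if Vertex.node v ∈ D.loops then 1 else 0

open Classical in
/-- `h_E = ∑_{{n, n'} ∈ E} (|n⟩ + |n'⟩)(⟨n| + ⟨n'|) ⊗ 1_j`. -/
def hE : Matrix (Vertex R) (Vertex R) ℂ :=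
  ∑ e ∈ D.edges, Matrix.of fun v w =>
    if Vertex.node v ∈ e ∧ Vertex.node w ∈ e ∧ v.2.2.2 = w.2.2.2 then 1 else 0

/-- `A(G) = 1_q ⊗ A(g₀) + h_S + h_E` for the gate graph `G` of the diagram. -/
def adj : Matrix (Vertex R) (Vertex R) ℂ :=
  (1 : Matrix (Fin R) (Fin R) ℂ) ⊗ₖ adjG0 + D.hS + D.hE

/-- The gate graph is an `e₁`-gate graph: the smallest eigenvalue of `A(G)` is `e₁`. -/
def IsE1GateGraph : Prop := IsLeast (eigenvalues D.adj) e1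

/-- The set of vertices whose node has neither a self-loop nor an edge. -/
def noLoop : Set (Vertex R) :=
  {v | Vertex.node v ∉ D.loops ∧ ∀ n, s(Vertex.node v, n) ∉ D.edges}

open Classical in
/-- The projector `Π_𝒩`. -/
def projNoLoop : Matrix (Vertex R) (Vertex R) ℂ :=
  Matrix.diagonal fun v => if v ∈ D.noLoop then 1 else 0

/-- `Π₊ = ½ (|0⟩ + |1⟩)(⟨0| + ⟨1|)`. -/
def projPlus : Matrix (Fin 2) (Fin 2) ℂ := (1 / 2 : ℂ) • !![1, 1; 1, 1]

/-- `A(G^SL) = A(G) ⊗ 1_d + 2 Π_𝒩 ⊗ Π₊`. -/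
def adjSL : Matrix (Vertex R × Fin 2) (Vertex R × Fin 2) ℂ :=
  D.adj ⊗ₖ (1 : Matrix (Fin 2) (Fin 2) ℂ) + (2 : ℂ) • (D.projNoLoop ⊗ₖ projPlus)

end GateDiagram

end BoseHubbard

end

/-! The penalty `2 Π_𝒩 ⊗ Π₊` splits `D.adjSL` according to the last register. On the antisymmetric
sector it is `D.adj`; on the symmetric sector it is `D.adj + 2 • D.projNoLoop`.

The symmetric sector lies a constant above `e1`. Every label leaves some time `t` without nodes, so
the penalty covers all vertices of an element at that time. After a Fourier transform in `j`, energy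
`e1` occurs only at momenta `1` and `7`, on histories `G (t+1) = U_t G t`. These carry equal weight
at all eight times, so a penalty at one time costs a fixed amount. Quantitatively this gives `1/256`
(`momentum_energy_ge`, `quadForm_adjG0_add_ge`). Since `h_S` and `h_E` are positive, the bound
passes to gate graphs (`quadForm_adj_add_projNoLoop_ge`). Hence the `e1`-eigenspace of `D.adjSL`
consists of antisymmetric lifts of that of `D.adj`, and its gap is at least `min γ (1/256)`
(`eigenvector_adjSL`, `min_gap_le`).

For the upper bound, lift an `N`-particle ground state by `|0⟩ - |1⟩` in every second register. The
one-particle energy per unit norm is unchanged and the interaction is halved, because two particles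
at one vertex of `G` share a copy with probability one half. So the ground energy does not increase,
and the factor `3/2` is slack.

For the lower bound, split a ground state of the doubled graph as `ψ = u + w`, with `u` its
projection to the common kernel of the one-particle terms. The gap controls `w` by the one-particle
energy (`exists_proj_common_kernel`). The part `u` is a lift (`exists_eq_antisymLift`), so its
interaction energy is at least half of `b` times its squared norm. The interaction is at most `N²`,
so replacing `u` by `ψ` costs a multiple of `N² ‖w‖²`. Balancing the two pieces gives
`gap_mul_groundEnergy_le`. -/

noncomputable section

namespace BoseHubbard

/-! ### Quadratic forms -/

section Quadratic

variable {ι κ : Type*} [Fintype ι] [Fintype κ]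

/-- The squared Euclidean norm of a vector. -/
def normSq (v : ι → ℂ) : ℝ := ∑ i, ‖v i‖ ^ 2

/-- The real quadratic form `Re ⟨v, M v⟩`. -/
def quadForm (M : Matrix ι ι ℂ) (v : ι → ℂ) : ℝ := (star v ⬝ᵥ M.mulVec v).re

theorem normSq_nonneg (v : ι → ℂ) : 0 ≤ normSq v := Finset.sum_nonneg fun _ _ => by positivity

theorem normSq_pos {v : ι → ℂ} (hv : v ≠ 0) : 0 < normSq v := by
  obtain ⟨i, hi⟩ := Function.ne_iff.mp hv
  exact Finset.sum_pos' (fun _ _ => by positivity)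
    ⟨i, Finset.mem_univ _, by have := norm_pos_iff.mpr hi; positivity⟩

theorem star_dotProduct_self (v : ι → ℂ) : star v ⬝ᵥ v = (normSq v : ℂ) := by
  simp only [dotProduct, normSq, Pi.star_apply, RCLike.star_def, Complex.ofReal_sum]
  refine Finset.sum_congr rfl fun i _ => ?_
  rw [Complex.conj_mul']
  push_cast; rfl

theorem quadForm_eq_sum (M : Matrix ι ι ℂ) (v : ι → ℂ) :
    quadForm M v = ∑ i, ∑ j, (star (v i) * (M i j * v j)).re := by
  simp [quadForm, dotProduct, Matrix.mulVec, Finset.mul_sum]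

theorem quadForm_add (M M' : Matrix ι ι ℂ) (v : ι → ℂ) :
    quadForm (M + M') v = quadForm M v + quadForm M' v := by
  simp [quadForm, Matrix.add_mulVec, dotProduct_add]

theorem quadForm_smul (c : ℝ) (M : Matrix ι ι ℂ) (v : ι → ℂ) :
    quadForm ((c : ℂ) • M) v = c * quadForm M v := by
  simp [quadForm, Matrix.smul_mulVec, dotProduct_smul]

theorem quadForm_sum {α : Type*} (s : Finset α) (M : α → Matrix ι ι ℂ) (v : ι → ℂ) :
    quadForm (∑ a ∈ s, M a) v = ∑ a ∈ s, quadForm (M a) v := by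
  simp [quadForm, Matrix.sum_mulVec, dotProduct_sum]

theorem quadForm_of_mulVec_eq {M : Matrix ι ι ℂ} {v : ι → ℂ} {x : ℝ}
    (h : M.mulVec v = (x : ℂ) • v) : quadForm M v = x * normSq v := by
  simp [quadForm, h, star_dotProduct_self, dotProduct_smul]

theorem quadForm_diagonal [DecidableEq ι] (d : ι → ℝ) (v : ι → ℂ) :
    quadForm (Matrix.diagonal fun i => (d i : ℂ)) v = ∑ i, d i * ‖v i‖ ^ 2 := by
  simp only [quadForm, dotProduct, Matrix.mulVec_diagonal, Complex.re_sum]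
  refine Finset.sum_congr rfl fun i _ => ?_
  rw [Pi.star_apply, RCLike.star_def, mul_left_comm, Complex.conj_mul', ← Complex.ofReal_pow,
    ← Complex.ofReal_mul, Complex.ofReal_re]

theorem quadForm_conj (U : Matrix ι κ ℂ) (M : Matrix κ κ ℂ) (v : ι → ℂ) :
    quadForm (U * M * U.conjTranspose) v = quadForm M (U.conjTranspose.mulVec v) := by
  rw [quadForm, quadForm, Matrix.star_mulVec, Matrix.conjTranspose_conjTranspose,
    ← Matrix.mulVec_mulVec, ← Matrix.mulVec_mulVec, Matrix.dotProduct_mulVec]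

/-- In finite dimension the infimum of the Rayleigh quotient is attained at an eigenvector; `m` is
that infimum. -/
theorem exists_hasEigenvalue_forall_mul_le {E : Type*} [NormedAddCommGroup E]
    [InnerProductSpace ℂ E] [FiniteDimensional ℂ E] [Nontrivial E] {T : E →ₗ[ℂ] E}
    (hT : T.IsSymmetric) :
    ∃ m : ℝ, Module.End.HasEigenvalue T (m : ℂ) ∧ ∀ x, m * ‖x‖ ^ 2 ≤ (inner ℂ x (T x)).re := by
  refine ⟨_, hT.hasEigenvalue_iInf_of_finiteDimensional, fun x => ?_⟩
  by_cases hx : x = 0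
  · simp [hx]
  -- A real `iInf` bounds its family from below only if the family is bounded below; the operator
  -- norm supplies the bound.
  have hbd : BddBelow (Set.range fun x : { x : E // x ≠ 0 } =>
      RCLike.re (inner ℂ (T x) (x : E)) / ‖(x : E)‖ ^ 2) := by
    let T' := LinearMap.toContinuousLinearMap T
    refine ⟨-‖T'‖, ?_⟩
    rintro _ ⟨⟨x, hx⟩, rfl⟩
    have hx' : 0 < ‖x‖ := norm_pos_iff.mpr hx
    rw [le_div_iff₀ (by positivity)]
    have h1 : |RCLike.re (inner ℂ (T x) x)| ≤ ‖T x‖ * ‖x‖ :=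
      (RCLike.abs_re_le_norm _).trans (norm_inner_le_norm _ _)
    have h2 : ‖T x‖ ≤ ‖T'‖ * ‖x‖ := T'.le_opNorm x
    have h3 := (abs_le.mp h1).1
    nlinarith
  have hx' : 0 < ‖x‖ := norm_pos_iff.mpr hx
  have := ciInf_le hbd ⟨x, hx⟩
  rw [le_div_iff₀ (by positivity)] at this
  rw [← hT x x]
  exact this

/-- The least eigenvalue of a Hermitian matrix on an invariant subspace, with its variational
characterization. -/
theorem exists_isLeast_eigenvaluesOn [DecidableEq ι] {M : Matrix ι ι ℂ} (hM : M.IsHermitian)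
    {Z : Submodule ℂ (ι → ℂ)} (hZ : ∀ v ∈ Z, M.mulVec v ∈ Z) (hne : ∃ v ∈ Z, v ≠ 0) :
    ∃ m, IsLeast (eigenvaluesOn M Z) m ∧ ∀ v ∈ Z, m * normSq v ≤ quadForm M v := by
  -- The type `ι → ℂ` carries the sup norm, so the variational argument runs on the copy of `Z`
  -- inside `EuclideanSpace`.
  let e := WithLp.linearEquiv 2 ℂ (ι → ℂ)
  let Z' : Submodule ℂ (EuclideanSpace ℂ ι) := Z.comap e.toLinearMap
  let T : Z' →ₗ[ℂ] Z' := (Matrix.toEuclideanLin M).restrict (p := Z') (q := Z') fun v hv => hZ _ hv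
  have hT : LinearMap.IsSymmetric (𝕜 := ℂ) (E := Z') T :=
    (Matrix.isSymmetric_toEuclideanLin_iff.mpr hM).restrict_invariant (V := Z') fun v hv => hZ _ hv
  have hnt : Nontrivial Z' := by
    obtain ⟨v, hv, hv0⟩ := hne
    refine ⟨⟨⟨e.symm v, by simpa [Z'] using hv⟩, 0, fun h => hv0 ?_⟩⟩
    have := congrArg (fun w : Z' => e w) h
    simpa using this
  obtain ⟨m, hev, hmin⟩ := exists_hasEigenvalue_forall_mul_le hT
  have hmem : m ∈ eigenvaluesOn M Z := by
    obtain ⟨w, hw⟩ := hev.exists_hasEigenvector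
    refine ⟨e w, w.2, fun h => hw.2 ?_, ?_⟩
    · exact Subtype.ext (e.injective (by simpa using h))
    · exact congrArg (fun w : Z' => e w) hw.apply_eq_smul
  have hray : ∀ v ∈ Z, m * normSq v ≤ quadForm M v := by
    intro v hv
    have := hmin ⟨e.symm v, by simpa [Z'] using hv⟩
    rw [Submodule.coe_inner, EuclideanSpace.inner_eq_star_dotProduct, dotProduct_comm,
      Submodule.coe_norm, EuclideanSpace.norm_sq_eq] at this
    exact this
  refine ⟨m, ⟨hmem, ?_⟩, hray⟩
  rintro x ⟨v, hv, hv0, hx⟩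
  have := hray v hv
  rw [quadForm_of_mulVec_eq hx] at this
  exact le_of_mul_le_mul_right this (normSq_pos hv0)

end Quadratic

/-! ### Operators on many registers -/

section ManyBody

variable {V : Type*} [Fintype V] [DecidableEq V] {N : ℕ}

/-- The tensor product of one-register operators. -/
def productOp (M : Fin N → Matrix V V ℂ) : Matrix (Fin N → V) (Fin N → V) ℂ :=
  Matrix.of fun x y => ∏ i, M i (x i) (y i)

omit [DecidableEq V] in
theorem productOp_mul (M M' : Fin N → Matrix V V ℂ) :
    productOp M * productOp M' = productOp fun i => M i * M' i := by
  ext x y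
  simp only [productOp, Matrix.mul_apply, Matrix.of_apply, Finset.prod_univ_sum,
    Fintype.piFinset_univ, Finset.prod_mul_distrib]

omit [Fintype V] in
theorem productOp_diagonal (d : Fin N → V → ℂ) :
    productOp (fun i => Matrix.diagonal (d i)) = Matrix.diagonal fun x => ∏ i, d i (x i) := by
  ext x y
  simp only [productOp, Matrix.of_apply, Matrix.diagonal_apply]
  split_ifs with h
  · subst h; simp
  · obtain ⟨i, hi⟩ := Function.ne_iff.mp h
    exact Finset.prod_eq_zero (Finset.mem_univ i) (by simp [hi])

omit [Fintype V] in
theorem productOp_one : productOp (fun _ : Fin N => (1 : Matrix V V ℂ)) = 1 := by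
  simpa using productOp_diagonal (fun (_ : Fin N) (_ : V) => (1 : ℂ))

omit [Fintype V] [DecidableEq V] in
theorem conjTranspose_productOp (M : Fin N → Matrix V V ℂ) :
    (productOp M).conjTranspose = productOp fun i => (M i).conjTranspose := by
  ext x y
  simp [productOp, Matrix.conjTranspose_apply]

-- In this form, conjugating by `U ⊗ ⋯ ⊗ U` acts register by register, which diagonalizes all the
-- `M^{(i)}` simultaneously.
omit [Fintype V] in
theorem onRegister_eq_productOp (M : Matrix V V ℂ) (i : Fin N) :
    onRegister N M i = productOp (Function.update (fun _ => 1) i M) := by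
  ext x y
  simp only [onRegister, productOp, Matrix.of_apply]
  rw [← Finset.mul_prod_erase _ _ (Finset.mem_univ i)]
  split_ifs with h
  · rw [Finset.prod_eq_one]
    · simp
    · intro j hj
      simp [Function.update_of_ne (Finset.ne_of_mem_erase hj), h j (Finset.ne_of_mem_erase hj)]
  · push Not at h
    obtain ⟨j, hj, hxy⟩ := h
    rw [Finset.prod_eq_zero (Finset.mem_erase.mpr ⟨hj, Finset.mem_univ j⟩), mul_zero]
    simp [Function.update_of_ne hj, hxy]

omit [Fintype V] in
theorem onRegister_diagonal (d : V → ℂ) (i : Fin N) :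
    onRegister N (Matrix.diagonal d) i = Matrix.diagonal fun x => d (x i) := by
  ext x y
  simp only [onRegister, Matrix.of_apply, Matrix.diagonal_apply]
  by_cases h : x = y
  · simp [h]
  · rw [if_neg h]
    split_ifs with h1 h2
    · exact absurd (funext fun j => if hj : j = i then hj ▸ h2 else h1 j hj) h
    · rfl
    · rfl

omit [Fintype V] in
theorem onRegister_isHermitian {M : Matrix V V ℂ} (hM : M.IsHermitian) (i : Fin N) :
    (onRegister N M i).IsHermitian := by
  rw [Matrix.IsHermitian, onRegister_eq_productOp, conjTranspose_productOp]
  congr 1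
  funext j
  by_cases h : j = i
  · subst h; simp only [Function.update_self]; exact hM
  · simp [Function.update_of_ne h]

omit [Fintype V] in
theorem onRegister_sub_smul_one (M : Matrix V V ℂ) (c : ℂ) (i : Fin N) :
    onRegister N (M - c • 1) i = onRegister N M i - c • 1 := by
  ext x y
  simp only [onRegister, Matrix.of_apply, Matrix.sub_apply, Matrix.smul_apply, Matrix.one_apply]
  by_cases h : x = y
  · simp [h]
  · split_ifs with h1 h2
    · exact absurd (funext fun j => if hj : j = i then hj ▸ h2 else h1 j hj) h
    · simp
    · simp

theorem onRegister_mulVec (M : Matrix V V ℂ) (i : Fin N) (f : (Fin N → V) → ℂ) (x : Fin N → V) :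
    (onRegister N M i).mulVec f x = ∑ a, M (x i) a * f (Function.update x i a) := by
  simp only [Matrix.mulVec, dotProduct, onRegister, Matrix.of_apply, ite_mul, zero_mul]
  rw [← Finset.sum_filter]
  refine Finset.sum_nbij' (fun y => y i) (fun a => Function.update x i a) ?_ ?_ ?_ ?_ ?_
  · simp
  · intro a _
    simp only [Finset.mem_filter, Finset.mem_univ, true_and]
    intro j hj
    simp [Function.update_of_ne hj]
  · intro y hy
    simp only [Finset.mem_filter, Finset.mem_univ, true_and] at hy
    funext j
    by_cases h : j = i
    · subst h; simp
    · simp [Function.update_of_ne h, hy j h]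
  · simp
  · intro y hy
    simp only [Finset.mem_filter, Finset.mem_univ, true_and] at hy
    have : Function.update x i (y i) = y := by
      funext j
      by_cases h : j = i
      · subst h; simp
      · simp [Function.update_of_ne h, hy j h]
    simp [this]

/-! ### Permutation symmetry -/

omit [Fintype V] in
theorem onRegister_comp_perm (M : Matrix V V ℂ) (i : Fin N) (p : Equiv.Perm (Fin N))
    (x y : Fin N → V) : onRegister N M i (x ∘ p) (y ∘ p) = onRegister N M (p i) x y := by
  simp only [onRegister, Matrix.of_apply, Function.comp_apply]
  congr 1
  refine propext ⟨fun h j hj => ?_, fun h j hj => h _ fun e => hj (p.injective e)⟩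
  have := h (p.symm j) fun e => hj (by simp [← e])
  simpa using this

/-- An invariant `f` equals its own average over permutations, and averaging a basis state gives a
multiple of `symState`. -/
theorem mem_bosonicSpace_iff {f : (Fin N → V) → ℂ} :
    f ∈ bosonicSpace V N ↔ ∀ (p : Equiv.Perm (Fin N)) x, f (x ∘ p) = f x := by
  constructor
  · intro hf
    induction hf using Submodule.span_induction with
    | mem f hf =>
      obtain ⟨y, rfl⟩ := hf
      intro p x
      simp only [symState, Pi.smul_apply, Finset.sum_apply, Pi.single_apply]
      congr 1
      refine Fintype.sum_equiv (Equiv.mulRight p⁻¹) _ _ fun q => ?_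
      congr 1
      refine propext ⟨fun h => ?_, fun h => ?_⟩
      · funext j
        have := congrFun h (p⁻¹ j)
        simpa using this
      · funext j
        have := congrFun h (p j)
        simpa using this
    | zero => simp
    | add f g _ _ hf hg => intro p x; simp [hf p x, hg p x]
    | smul c f _ hf => intro p x; simp [hf p x]
  · intro hf
    have hN : (N.factorial : ℂ) ≠ 0 := by exact_mod_cast N.factorial_ne_zero
    have hs : ((1 / Real.sqrt (N.factorial : ℝ) : ℝ) : ℂ) ≠ 0 := by
      have : (0 : ℝ) < N.factorial := by exact_mod_cast N.factorial_pos
      exact_mod_cast (by positivity : (1 / Real.sqrt (N.factorial : ℝ)) ≠ 0)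
    have key : f = (N.factorial : ℂ)⁻¹ • ∑ x, f x •
        (((1 / Real.sqrt (N.factorial : ℝ) : ℝ) : ℂ)⁻¹ • symState N x) := by
      funext y
      have h1 : ∀ x, (((1 / Real.sqrt (N.factorial : ℝ) : ℝ) : ℂ)⁻¹ • symState N x) y =
          ∑ p : Equiv.Perm (Fin N), if y ∘ p.symm = x then 1 else 0 := by
        intro x
        rw [symState, smul_smul, inv_mul_cancel₀ hs, one_smul, Finset.sum_apply]
        refine Finset.sum_congr rfl fun p _ => ?_
        rw [Pi.single_apply]
        congr 1
        refine propext ⟨fun h => ?_, fun h => ?_⟩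
        · subst h; funext j; simp
        · subst h; funext j; simp
      simp only [Pi.smul_apply, Finset.sum_apply, smul_eq_mul] at h1 ⊢
      simp only [h1, Finset.mul_sum]
      rw [Finset.sum_comm]
      simp only [mul_ite, mul_one, mul_zero, Finset.sum_ite_eq, Finset.mem_univ, if_true]
      simp only [hf, Finset.sum_const, Finset.card_univ, Fintype.card_perm, Fintype.card_fin,
        nsmul_eq_mul]
      rw [← mul_assoc, mul_inv_cancel₀ hN, one_mul]
    rw [key]
    exact Submodule.smul_mem _ _ (Submodule.sum_mem _ fun x _ => Submodule.smul_mem _ _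
      (Submodule.smul_mem _ _ (Submodule.subset_span ⟨x, rfl⟩)))

theorem mulVec_mem_bosonicSpace {M : Matrix (Fin N → V) (Fin N → V) ℂ}
    (hM : ∀ (p : Equiv.Perm (Fin N)) x y, M (x ∘ p) (y ∘ p) = M x y) {f : (Fin N → V) → ℂ}
    (hf : f ∈ bosonicSpace V N) : M.mulVec f ∈ bosonicSpace V N := by
  rw [mem_bosonicSpace_iff] at hf ⊢
  intro p x
  simp only [Matrix.mulVec, dotProduct]
  refine (Fintype.sum_equiv (Equiv.arrowCongr p.symm (Equiv.refl V)) _ _ fun y => ?_).symm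
  have : Equiv.arrowCongr p.symm (Equiv.refl V) y = y ∘ p := by
    funext j; simp [Equiv.arrowCongr]
  rw [this, hM, hf]

/-! ### The Hamiltonian -/

/-- The number of ordered pairs of distinct registers that hold the same vertex. -/
def collisions (x : Fin N → V) : ℝ := ∑ i, ∑ j, if i ≠ j ∧ x i = x j then 1 else 0

omit [Fintype V] in
theorem collisions_nonneg (x : Fin N → V) : 0 ≤ collisions x :=
  Finset.sum_nonneg fun _ _ => Finset.sum_nonneg fun _ _ => by split_ifs <;> norm_num

omit [Fintype V] in
theorem collisions_le (x : Fin N → V) : collisions x ≤ (N : ℝ) ^ 2 := by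
  calc collisions x ≤ ∑ _i : Fin N, ∑ _j : Fin N, (1 : ℝ) :=
        Finset.sum_le_sum fun _ _ => Finset.sum_le_sum fun _ _ => by split_ifs <;> norm_num
    _ = (N : ℝ) ^ 2 := by simp [sq]

omit [Fintype V] in
theorem collisions_comp_perm (x : Fin N → V) (p : Equiv.Perm (Fin N)) :
    collisions (x ∘ p) = collisions x := by
  unfold collisions
  refine Fintype.sum_equiv p _ _ fun i => Fintype.sum_equiv p _ _ fun j => ?_
  simp

omit [Fintype V] in
theorem numberOp_eq_diagonal (k : V) : numberOp N k =
    Matrix.diagonal fun x => ∑ i, if x i = k then (1 : ℂ) else 0 := by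
  have h : Matrix.single k k (1 : ℂ) = Matrix.diagonal fun v => if v = k then 1 else 0 := by
    ext a b
    simp only [Matrix.single_apply, Matrix.diagonal_apply]
    grind
  simp only [numberOp, h, onRegister_diagonal]
  ext x y
  simp only [Matrix.sum_apply, Matrix.diagonal_apply]
  split_ifs <;> simp

/-- The operator `n̂_k (n̂_k - 1)` is diagonal and counts ordered pairs of distinct registers that
both hold `k`; summing over `k` counts all coincidences. -/
theorem hamiltonian_eq (A : Matrix V V ℂ) : hamiltonian N A =
    ∑ i, onRegister N A i + Matrix.diagonal fun x => (collisions x : ℂ) := by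
  rw [hamiltonian]
  congr 1
  have h : ∀ k : V, numberOp N k * (numberOp N k - 1) = Matrix.diagonal fun x : Fin N → V =>
      ∑ i, ∑ j, if i ≠ j then (if x i = k then if x j = k then (1 : ℂ) else 0 else 0) else 0 := by
    intro k
    rw [numberOp_eq_diagonal, ← Matrix.diagonal_one, Matrix.diagonal_sub,
      Matrix.diagonal_mul_diagonal]
    congr 1
    funext x
    rw [Finset.sum_mul]
    refine Finset.sum_congr rfl fun i _ => ?_
    by_cases hi : x i = k
    · rw [← Finset.add_sum_erase _ _ (Finset.mem_univ i),
        ← Finset.add_sum_erase (s := Finset.univ) (a := i) (h := Finset.mem_univ i)]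
      simp only [hi, if_true, one_mul, add_sub_cancel_left, ne_eq, not_true_eq_false, if_false,
        zero_add]
      refine Finset.sum_congr rfl fun j hj => ?_
      rw [if_pos (Finset.ne_of_mem_erase hj).symm]
    · simp [hi]
  simp only [h]
  ext x y
  simp only [Matrix.sum_apply, Matrix.diagonal_apply]
  by_cases hxy : x = y
  · subst hxy
    simp only [if_true, collisions, Complex.ofReal_sum]
    rw [Finset.sum_comm]
    refine Finset.sum_congr rfl fun i _ => ?_
    rw [Finset.sum_comm]
    refine Finset.sum_congr rfl fun j _ => ?_
    by_cases hij : i = j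
    · simp [hij]
    · by_cases hx : x i = x j <;> simp [hij, hx, eq_comm]
  · simp [hxy]

/-- The Hamiltonian shifted by `N` times `m` is the sum of the shifted one-particle terms and the
interaction. -/
theorem hamiltonian_sub_eq (A : Matrix V V ℂ) (m : ℝ) :
    hamiltonian N A - (((N : ℝ) * m : ℝ) : ℂ) • 1 =
      ∑ i, onRegister N (A - (m : ℂ) • 1) i + Matrix.diagonal fun x => (collisions x : ℂ) := by
  simp only [hamiltonian_eq, onRegister_sub_smul_one, Finset.sum_sub_distrib, Finset.sum_const,
    Finset.card_univ, Fintype.card_fin]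
  rw [← Nat.cast_smul_eq_nsmul ℂ, smul_smul]
  push_cast
  abel

theorem quadForm_hamiltonian_sub (A : Matrix V V ℂ) (m : ℝ) (f : (Fin N → V) → ℂ) :
    quadForm (hamiltonian N A - (((N : ℝ) * m : ℝ) : ℂ) • 1) f =
      quadForm (∑ i, onRegister N (A - (m : ℂ) • 1) i) f + ∑ x, collisions x * ‖f x‖ ^ 2 := by
  rw [hamiltonian_sub_eq, quadForm_add, quadForm_diagonal]

omit [Fintype V] in
theorem sum_onRegister_comp_perm (M : Matrix V V ℂ) (p : Equiv.Perm (Fin N)) (x y : Fin N → V) :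
    (∑ i, onRegister N M i) (x ∘ p) (y ∘ p) = (∑ i, onRegister N M i) x y := by
  simp only [Matrix.sum_apply, onRegister_comp_perm]
  exact Equiv.sum_comp p fun i => onRegister N M i x y

/-- The variational characterization of `groundEnergy`. -/
theorem groundEnergy_spec [Nonempty V] {A : Matrix V V ℂ} (hA : A.IsHermitian) (N : ℕ) :
    IsLeast (eigenvaluesOn (hamiltonian N A - (((N : ℝ) * minEigenvalue A : ℝ) : ℂ) • 1)
      (bosonicSpace V N)) (groundEnergy N A) ∧
    ∀ f ∈ bosonicSpace V N, groundEnergy N A * normSq f ≤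
      quadForm (hamiltonian N A - (((N : ℝ) * minEigenvalue A : ℝ) : ℂ) • 1) f := by
  have hherm : (hamiltonian N A - (((N : ℝ) * minEigenvalue A : ℝ) : ℂ) • 1).IsHermitian := by
    rw [hamiltonian_eq]
    refine (Matrix.IsHermitian.add ?_ ?_).sub ?_
    · exact isSelfAdjoint_sum _ fun i _ => onRegister_isHermitian hA i
    · refine Matrix.isHermitian_diagonal_of_self_adjoint _ ?_
      funext x
      simp
    · exact Matrix.isHermitian_one.smul (by simp [IsSelfAdjoint])
  have hinv : ∀ f ∈ bosonicSpace V N,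
      (hamiltonian N A - (((N : ℝ) * minEigenvalue A : ℝ) : ℂ) • 1).mulVec f ∈
        bosonicSpace V N := by
    intro f hf
    rw [hamiltonian_sub_eq]
    refine mulVec_mem_bosonicSpace (fun p x y => ?_) hf
    simp only [Matrix.add_apply, sum_onRegister_comp_perm, Matrix.diagonal_apply,
      collisions_comp_perm]
    congr 2
    exact propext ⟨fun h => p.surjective.injective_comp_right h, fun h => h ▸ rfl⟩
  -- The constant function is symmetric, so the bosonic space is nonzero for every `N`, including `N
  -- = 0`.
  have hne : ∃ f ∈ bosonicSpace V N, f ≠ 0 := by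
    refine ⟨fun _ => 1, mem_bosonicSpace_iff.mpr fun _ _ => rfl, fun h => ?_⟩
    exact one_ne_zero (congrFun h fun _ => Classical.arbitrary V)
  obtain ⟨m, hm, hray⟩ := exists_isLeast_eigenvaluesOn hherm hinv hne
  have : groundEnergy N A = m := hm.csInf_eq
  rw [this]
  exact ⟨hm, hray⟩

/-! ### The kernel of the one-particle part -/

/-- If the nonzero eigenvalues of the positive semidefinite matrix `K` are at least `g`, then
`∑ᵢ K^{(i)}` has gap `g` above the common kernel of the `K^{(i)}`. -/
theorem exists_proj_common_kernel {K : Matrix V V ℂ} (hK : K.IsHermitian) {g : ℝ}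
    (hnonneg : ∀ x ∈ eigenvalues K, 0 ≤ x) (hgap : ∀ x ∈ eigenvalues K, x ≠ 0 → g ≤ x) (N : ℕ) :
    ∃ Q : Matrix (Fin N → V) (Fin N → V) ℂ,
      (∀ (p : Equiv.Perm (Fin N)) x y, Q (x ∘ p) (y ∘ p) = Q x y) ∧
      (∀ i, onRegister N K i * Q = 0) ∧
      ∀ f, g * normSq (f - Q.mulVec f) ≤ quadForm (∑ i, onRegister N K i) f := by
  set k := hK.eigenvalues with hk
  set U : Matrix V V ℂ := ↑hK.eigenvectorUnitary
  have hUU : U * U.conjTranspose = 1 := Unitary.coe_mul_star_self hK.eigenvectorUnitary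
  have hUU' : U.conjTranspose * U = 1 := Unitary.coe_star_mul_self hK.eigenvectorUnitary
  have hspec : K = U * Matrix.diagonal (fun a => (k a : ℂ)) * U.conjTranspose := by
    conv_lhs => rw [hK.spectral_theorem, Unitary.conjStarAlgAut_apply]
    rfl
  have hmem : ∀ a, k a ∈ eigenvalues K := fun a =>
    ⟨hK.eigenvectorBasis a, trivial, fun h => (hK.eigenvectorBasis.orthonormal.ne_zero a)
      (WithLp.ofLp_injective 2 h), by
        rw [hK.mulVec_eigenvectorBasis]; ext; simp [hk]⟩
  -- `P = U χ U*` projects to the kernel of `K`. The required `Q` is `P ⊗ ⋯ ⊗ P`, diagonal in the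
  -- same product eigenbasis `W` as every `K^{(i)}`.
  let χ : V → ℂ := fun a => if k a = 0 then 1 else 0
  let W : Matrix (Fin N → V) (Fin N → V) ℂ := productOp fun _ => U
  have hWW : W * W.conjTranspose = 1 := by
    simp only [W, conjTranspose_productOp, productOp_mul, hUU, productOp_one]
  have hWW' : W.conjTranspose * W = 1 := by
    simp only [W, conjTranspose_productOp, productOp_mul, hUU', productOp_one]
  have hreg : ∀ i, onRegister N K i =
      W * (Matrix.diagonal fun a => (k (a i) : ℂ)) * W.conjTranspose := by
    intro i
    rw [← onRegister_diagonal (fun a => (k a : ℂ)), onRegister_eq_productOp,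
      onRegister_eq_productOp, conjTranspose_productOp, productOp_mul, productOp_mul]
    congr 1
    funext j
    by_cases h : j = i
    · subst h; simpa using hspec
    · simp [Function.update_of_ne h, hUU]
  let χN : (Fin N → V) → ℝ := fun a => if ∀ i, k (a i) = 0 then 1 else 0
  let P : Matrix V V ℂ := U * Matrix.diagonal χ * U.conjTranspose
  have hQ : productOp (fun _ : Fin N => P) =
      W * (Matrix.diagonal fun a => (χN a : ℂ)) * W.conjTranspose := by
    have : (fun a => (χN a : ℂ)) = fun a : Fin N → V => ∏ i, χ (a i) := by
      funext a
      simp only [χN, χ]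
      split_ifs with h
      · simp [h]
      · push Not at h
        obtain ⟨i, hi⟩ := h
        rw [Finset.prod_eq_zero (Finset.mem_univ i) (if_neg hi)]
        simp
    rw [this, ← productOp_diagonal (fun _ => χ), conjTranspose_productOp, productOp_mul,
      productOp_mul]
  refine ⟨productOp fun _ => P, fun p x y => ?_, fun i => ?_, fun f => ?_⟩
  · simp only [productOp, Matrix.of_apply, Function.comp_apply]
    exact Equiv.prod_comp p fun i => P (x i) (y i)
  · rw [hQ, hreg]
    calc W * (Matrix.diagonal fun a => (k (a i) : ℂ)) * W.conjTranspose *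
          (W * (Matrix.diagonal fun a => (χN a : ℂ)) * W.conjTranspose)
        = W * (Matrix.diagonal fun a => (k (a i) : ℂ)) * (W.conjTranspose * W) *
          (Matrix.diagonal fun a => (χN a : ℂ)) * W.conjTranspose := by
          simp only [Matrix.mul_assoc]
      _ = 0 := by
          rw [hWW', Matrix.mul_one, Matrix.mul_assoc W, Matrix.diagonal_mul_diagonal]
          have : (fun a : Fin N → V => (k (a i) : ℂ) * (χN a : ℂ)) = fun _ => 0 := by
            funext a
            simp only [χN]
            split_ifs with h
            · simp [h i]
            · simp
          simp [this]
  · set h := W.conjTranspose.mulVec f with hh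
    have hf : f = W.mulVec h := by rw [hh, Matrix.mulVec_mulVec, hWW, Matrix.one_mulVec]
    have hkin : quadForm (∑ i, onRegister N K i) f = ∑ a, (∑ i, k (a i)) * ‖h a‖ ^ 2 := by
      rw [quadForm_sum]
      simp only [hreg, quadForm_conj, ← hh, Finset.sum_mul]
      rw [Finset.sum_comm]
      exact Finset.sum_congr rfl fun i _ => quadForm_diagonal (fun a : Fin N → V => k (a i)) h
    have hdiff : f - (productOp fun _ : Fin N => P).mulVec f =
        W.mulVec (fun a => ((1 - χN a : ℝ) : ℂ) * h a) := by
      rw [hQ, ← Matrix.mulVec_mulVec, ← hh, ← Matrix.mulVec_mulVec]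
      conv_lhs => rw [hf]
      rw [← Matrix.mulVec_sub]
      congr 1
      funext a
      simp [Matrix.mulVec_diagonal]
      ring
    have hnorm : ∀ w, normSq (W.mulVec w) = normSq w := by
      intro w
      have : ((normSq (W.mulVec w) : ℝ) : ℂ) = normSq w := by
        rw [← star_dotProduct_self, ← star_dotProduct_self, Matrix.star_mulVec,
          ← Matrix.dotProduct_mulVec, Matrix.mulVec_mulVec, hWW', Matrix.one_mulVec]
      exact_mod_cast this
    rw [hkin, hdiff, hnorm, normSq, Finset.mul_sum]
    refine Finset.sum_le_sum fun a _ => ?_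
    simp only [χN]
    split_ifs with hz
    · simp [hz]
    · push Not at hz
      obtain ⟨i, hi⟩ := hz
      have h1 : k (a i) ≤ ∑ i, k (a i) :=
        Finset.single_le_sum (f := fun i => k (a i)) (fun j _ => hnonneg _ (hmem _))
          (Finset.mem_univ i)
      have h2 := hgap _ (hmem (a i)) hi
      simp only [sub_zero, Complex.ofReal_one, one_mul]
      gcongr
      exact h2.trans h1

end ManyBody

/-! ### The spectrum of `g₀` -/

section Fourier

open ZMod

theorem norm_stdAddChar (x : ZMod 8) : ‖stdAddChar x‖ = 1 := by
  rw [stdAddChar_apply]; exact Circle.norm_coe _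

theorem star_stdAddChar (x : ZMod 8) : star (stdAddChar x) = stdAddChar (-x) := by
  rw [stdAddChar_apply, stdAddChar_apply, AddChar.map_neg_eq_inv, Circle.coe_inv_eq_conj]; rfl

/-- The discrete Fourier transform on `ZMod 8`. -/
def fourier (a : ZMod 8 → ℂ) (k : ZMod 8) : ℂ := ∑ j, stdAddChar (k * j) * a j

theorem fourier_parseval (a b : ZMod 8 → ℂ) :
    ∑ k, star (fourier a k) * fourier b k = 8 * ∑ j, star (a j) * b j := by
  have h : ∀ k, star (fourier a k) * fourier b k =
      ∑ i, ∑ j, stdAddChar (k * (j - i)) * (star (a i) * b j) := by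
    intro k
    simp only [fourier, star_sum, Finset.sum_mul_sum, star_mul', star_stdAddChar]
    refine Finset.sum_congr rfl fun i _ => Finset.sum_congr rfl fun j _ => ?_
    rw [mul_sub, sub_eq_add_neg, AddChar.map_add_eq_mul]
    ring
  simp only [h]
  rw [Finset.sum_comm, Finset.mul_sum]
  refine Finset.sum_congr rfl fun i _ => ?_
  rw [Finset.sum_comm]
  simp only [← Finset.sum_mul, AddChar.sum_mulShift _ (isPrimitive_stdAddChar 8), sub_eq_zero,
    ZMod.card]
  simp

theorem fourier_shift (a : ZMod 8 → ℂ) (c k : ZMod 8) :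
    fourier (fun j => a (j + c)) k = stdAddChar (-(k * c)) * fourier a k := by
  simp only [fourier, Finset.mul_sum]
  refine Fintype.sum_equiv (Equiv.addRight c) _ _ fun j => ?_
  simp only [Equiv.coe_addRight]
  rw [← mul_assoc, ← AddChar.map_add_eq_mul]
  congr 2
  ring

/-- A shift becomes a phase in each Fourier mode, so matrix elements of powers of `S` decouple over
momenta. -/
theorem sum_star_shift_mul (a b : ZMod 8 → ℂ) (c : ZMod 8) :
    8 * ∑ j, star (a (j + c)) * b j =
      ∑ k, stdAddChar (k * c) * (star (fourier a k) * fourier b k) := by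
  rw [← fourier_parseval (fun j => a (j + c)) b]
  refine Finset.sum_congr rfl fun k _ => ?_
  rw [fourier_shift, star_mul', star_stdAddChar, neg_neg, mul_assoc]

theorem sum_norm_sq_fourier (a : ZMod 8 → ℂ) :
    ∑ k, ‖fourier a k‖ ^ 2 = 8 * ∑ j, ‖a j‖ ^ 2 := by
  have := fourier_parseval a a
  simp only [RCLike.star_def, Complex.conj_mul'] at this
  exact_mod_cast this

theorem stdAddChar_re (n : ℤ) : (stdAddChar (n : ZMod 8)).re = Real.cos (n * (Real.pi / 4)) := by
  have h := stdAddChar_coe (N := 8) n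
  have h2 : (2 * Real.pi * Complex.I * n / (8 : ℕ) : ℂ) =
      ((n * (Real.pi / 4) : ℝ) : ℂ) * Complex.I := by
    push_cast; ring
  rw [h2] at h
  rw [h, Complex.exp_ofReal_mul_I_re]

theorem stdAddChar_four_mul (k : ZMod 8) (hk : k = 1 ∨ k = 7) :
    stdAddChar (k * 4) = (-1 : ℂ) := by
  have h1 : k * 4 = ((4 : ℤ) : ZMod 8) := by rcases hk with rfl | rfl <;> decide
  rw [h1, stdAddChar_coe]
  have h2 : (2 * Real.pi * Complex.I * (4 : ℤ) / (8 : ℕ) : ℂ) = Real.pi * Complex.I := by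
    push_cast; ring
  rw [h2, Complex.exp_pi_mul_I]

theorem stdAddChar_re_neg (x : ZMod 8) : (stdAddChar (-x)).re = (stdAddChar x).re := by
  rw [← star_stdAddChar]; rfl

theorem stdAddChar_re_one : (stdAddChar (1 : ZMod 8)).re = Real.sqrt 2 / 2 := by
  have := stdAddChar_re 1
  simpa using this

theorem stdAddChar_re_two : (stdAddChar (2 : ZMod 8)).re = 0 := by
  have := stdAddChar_re 2
  rwa [show ((2 : ℤ) : ℝ) * (Real.pi / 4) = Real.pi / 2 by push_cast; ring,
    Real.cos_pi_div_two] at this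

theorem stdAddChar_re_three : (stdAddChar (3 : ZMod 8)).re = -(Real.sqrt 2 / 2) := by
  have := stdAddChar_re 3
  rwa [show ((3 : ℤ) : ℝ) * (Real.pi / 4) = Real.pi - Real.pi / 4 by push_cast; ring,
    Real.cos_pi_sub, Real.cos_pi_div_four] at this

theorem stdAddChar_re_four : (stdAddChar (4 : ZMod 8)).re = -1 := by
  have := stdAddChar_re 4
  rwa [show ((4 : ℤ) : ℝ) * (Real.pi / 4) = Real.pi by push_cast; ring, Real.cos_pi] at this

/-- The eigenvalue of `S³ + S⁴ + S⁵` at momentum `k`. -/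
def shiftEnergy (k : ZMod 8) : ℝ :=
  (stdAddChar (k * 3)).re + (stdAddChar (k * 4)).re + (stdAddChar (k * 5)).re

theorem shiftEnergy_eq (k : ZMod 8) :
    shiftEnergy k = 2 * (stdAddChar (k * 3)).re + (stdAddChar (k * 4)).re := by
  have h : k * 5 = -(k * 3) := by revert k; decide
  rw [shiftEnergy, h, stdAddChar_re_neg]
  ring

theorem shiftEnergy_of_eq {k : ZMod 8} (hk : k = 1 ∨ k = 7) :
    shiftEnergy k = -1 - Real.sqrt 2 := by
  rw [shiftEnergy_eq]
  rcases hk with rfl | rfl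
  · rw [one_mul, one_mul, stdAddChar_re_three, stdAddChar_re_four]; ring
  · rw [show (7 * 3 : ZMod 8) = -3 by decide, show (7 * 4 : ZMod 8) = 4 by decide,
      stdAddChar_re_neg, stdAddChar_re_three, stdAddChar_re_four]
    ring

/-- The remaining values are `3`, `√2 - 1`, `1` and `-1`, the last at `k = 4`. This separation is
why `S³ + S⁴ + S⁵` singles out momenta `1` and `7`. -/
theorem neg_one_le_shiftEnergy {k : ZMod 8} (hk : ¬ (k = 1 ∨ k = 7)) : -1 ≤ shiftEnergy k := by
  have hs : 0 ≤ Real.sqrt 2 := Real.sqrt_nonneg 2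
  have h0 : (stdAddChar (0 : ZMod 8)).re = 1 := by simp
  have hcases : (k * 3 = 0 ∧ k * 4 = 0) ∨ (k * 3 = 1 ∧ k * 4 = 4) ∨ (k * 3 = -1 ∧ k * 4 = 4) ∨
      (k * 3 = 2 ∧ k * 4 = 0) ∨ (k * 3 = -2 ∧ k * 4 = 0) ∨ (k * 3 = 4 ∧ k * 4 = 0) := by
    revert k; decide
  rw [shiftEnergy_eq]
  rcases hcases with h | h | h | h | h | h <;> rw [h.1, h.2] <;>
    simp only [stdAddChar_re_neg, h0, stdAddChar_re_one, stdAddChar_re_two,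
      stdAddChar_re_four] <;> linarith

end Fourier

/-! ### Hopping at fixed momentum and history states -/

section Momentum

open ZMod

/-- The hopping amplitude from `(z, t)` to `(z', t + 1)` at momentum `k`. -/
def hop (k t : ZMod 8) (z' z : Fin 2) : ℂ := stdAddChar (k * gateExp t z' z)

theorem norm_hop (k t : ZMod 8) (z' z : Fin 2) : ‖hop k t z' z‖ = 1 := norm_stdAddChar _

/-- The energy of the hopping terms at momentum `k`. -/
def hopEnergy (k : ZMod 8) (G : Fin 2 → ZMod 8 → ℂ) : ℝ :=
  ∑ t, ∑ z, ∑ z', 2 * (hop k t z' z * (star (G z' (t + 1)) * G z t)).re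

/-- The weight of `G` at time `t`. -/
def timeWeight (G : Fin 2 → ZMod 8 → ℂ) (t : ZMod 8) : ℝ := ∑ z, ‖G z t‖ ^ 2

theorem timeWeight_nonneg (G : Fin 2 → ZMod 8 → ℂ) (t : ZMod 8) : 0 ≤ timeWeight G t :=
  Finset.sum_nonneg fun _ _ => by positivity

theorem sum_timeWeight_add_one (G : Fin 2 → ZMod 8 → ℂ) :
    ∑ t, timeWeight G (t + 1) = ∑ t, timeWeight G t :=
  Equiv.sum_comp (Equiv.addRight 1) fun t => timeWeight G t

theorem neg_le_two_mul_re {h x y : ℂ} (hh : ‖h‖ = 1) :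
    -(‖x‖ ^ 2 + ‖y‖ ^ 2) ≤ 2 * (h * (star x * y)).re := by
  have h1 : |(h * (star x * y)).re| ≤ ‖x‖ * ‖y‖ := by
    refine (Complex.abs_re_le_norm _).trans ?_
    simp [hh]
  have := (abs_le.mp h1).1
  nlinarith [sq_nonneg (‖x‖ - ‖y‖)]

/-- Each `(z, t)` takes part in four hops, two forward and two backward, all with amplitudes of
modulus one. -/
theorem neg_four_mul_le_hopEnergy (k : ZMod 8) (G : Fin 2 → ZMod 8 → ℂ) :
    -4 * ∑ t, timeWeight G t ≤ hopEnergy k G := by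
  have h : ∀ t, -2 * (timeWeight G (t + 1) + timeWeight G t) ≤
      ∑ z, ∑ z', 2 * (hop k t z' z * (star (G z' (t + 1)) * G z t)).re := by
    intro t
    have hb := fun z z' => neg_le_two_mul_re (x := G z' (t + 1)) (y := G z t) (norm_hop k t z' z)
    simp only [timeWeight, Fin.sum_univ_two]
    have := hb 0 0; have := hb 0 1; have := hb 1 0; have := hb 1 1
    linarith
  have := Finset.sum_le_sum fun t (_ : t ∈ Finset.univ) => h t
  rw [← Finset.mul_sum, Finset.sum_add_distrib, sum_timeWeight_add_one] at this
  unfold hopEnergy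
  linarith

/-- At momenta with `stdAddChar (k * 4) = -1`, this makes the two columns of the hopping matrix
orthogonal. -/
theorem gateExp_column (t : ZMod 8) :
    gateExp t 1 1 = gateExp t 1 0 + (gateExp t 0 1 - gateExp t 0 0) + 4 := by
  revert t; decide

/-- At momenta `1` and `7` every gate acts as `√2` times a unitary. -/
theorem sum_norm_sq_hop {k : ZMod 8} (hk : k = 1 ∨ k = 7) (t : ZMod 8) (y : Fin 2 → ℂ) :
    ∑ z', ‖∑ z, hop k t z' z * y z‖ ^ 2 = 2 * ∑ z, ‖y z‖ ^ 2 := by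
  set δ : ℂ := stdAddChar (k * (gateExp t 0 1 - gateExp t 0 0)) with hδ
  have hδn : ‖δ‖ = 1 := norm_stdAddChar _
  have h01 : hop k t 0 1 = hop k t 0 0 * δ := by
    rw [hop, hop, hδ, ← AddChar.map_add_eq_mul]; congr 1; ring
  have h11 : hop k t 1 1 = -(hop k t 1 0 * δ) := by
    rw [hop, gateExp_column, mul_add, mul_add, AddChar.map_add_eq_mul, AddChar.map_add_eq_mul,
      stdAddChar_four_mul k hk, hop, hδ]
    ring
  simp only [Fin.sum_univ_two, h01, h11]
  rw [show hop k t 0 0 * y 0 + hop k t 0 0 * δ * y 1 = hop k t 0 0 * (y 0 + δ * y 1) by ring,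
    show hop k t 1 0 * y 0 + -(hop k t 1 0 * δ) * y 1 = hop k t 1 0 * (y 0 - δ * y 1) by ring,
    norm_mul, norm_mul, norm_hop, norm_hop, one_mul, one_mul]
  have := parallelogram_law_with_norm ℝ (y 0) (δ * y 1)
  rw [norm_mul, hδn, one_mul] at this
  linarith

theorem norm_sq_add_expand (x c : ℂ) (s : ℝ) :
    ‖x + (s : ℂ) * c‖ ^ 2 = ‖x‖ ^ 2 + 2 * s * (star x * c).re + s ^ 2 * ‖c‖ ^ 2 := by
  simp only [← Complex.normSq_eq_norm_sq, Complex.normSq_apply, Complex.add_re, Complex.add_im,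
    Complex.mul_re, Complex.mul_im, Complex.ofReal_re, Complex.ofReal_im, RCLike.star_def,
    Complex.conj_re, Complex.conj_im]
  ring

/-- The defect `‖G_{t+1} - U_t G_t‖²` of a history at time `t`. -/
def defect (k : ZMod 8) (G : Fin 2 → ZMod 8 → ℂ) (t : ZMod 8) : ℝ :=
  ∑ z', ‖G z' (t + 1) + ((Real.sqrt 2 / 2 : ℝ) : ℂ) * ∑ z, hop k t z' z * G z t‖ ^ 2

theorem defect_nonneg (k : ZMod 8) (G : Fin 2 → ZMod 8 → ℂ) (t : ZMod 8) : 0 ≤ defect k G t :=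
  Finset.sum_nonneg fun _ _ => by positivity

/-- The hopping energy is the cross term in the expanded square; unitarity evaluates the remaining
terms. So exact histories minimize it. -/
theorem sqrt_two_mul_defect {k : ZMod 8} (hk : k = 1 ∨ k = 7) (G : Fin 2 → ZMod 8 → ℂ)
    (t : ZMod 8) :
    ∑ z, ∑ z', 2 * (hop k t z' z * (star (G z' (t + 1)) * G z t)).re =
      Real.sqrt 2 * (defect k G t - timeWeight G (t + 1) - timeWeight G t) := by
  have hs : Real.sqrt 2 ^ 2 = 2 := Real.sq_sqrt (by norm_num)
  have h1 : ∑ z, ∑ z', 2 * (hop k t z' z * (star (G z' (t + 1)) * G z t)).re =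
      2 * ∑ z', (star (G z' (t + 1)) * ∑ z, hop k t z' z * G z t).re := by
    rw [Finset.sum_comm, Finset.mul_sum]
    refine Finset.sum_congr rfl fun z' _ => ?_
    rw [Finset.mul_sum, Complex.re_sum, Finset.mul_sum]
    refine Finset.sum_congr rfl fun z _ => ?_
    rw [mul_left_comm]
  have h2 := sum_norm_sq_hop hk t fun z => G z t
  rw [h1]
  simp only [defect, norm_sq_add_expand, Finset.sum_add_distrib, ← Finset.mul_sum, h2, timeWeight]
  linear_combination (-(∑ z', (star (G z' (t + 1)) * ∑ z, hop k t z' z * G z t).re) -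
    Real.sqrt 2 / 2 * ∑ z, ‖G z t‖ ^ 2) * hs

/-- `G (t+1)` is the unitary image of `G t` plus an error whose squared norm is the defect; then `‖x
+ y‖² ≤ 2‖x‖² + 2‖y‖²`. -/
theorem timeWeight_add_one_le {k : ZMod 8} (hk : k = 1 ∨ k = 7) (G : Fin 2 → ZMod 8 → ℂ)
    (t : ZMod 8) : timeWeight G (t + 1) ≤ 2 * timeWeight G t + 2 * defect k G t := by
  have hs : Real.sqrt 2 ^ 2 = 2 := Real.sq_sqrt (by norm_num)
  have h2 := sum_norm_sq_hop hk t fun z => G z t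
  have h3 : timeWeight G t = ∑ z', ‖((Real.sqrt 2 / 2 : ℝ) : ℂ) * ∑ z, hop k t z' z * G z t‖ ^ 2 := by
    simp only [norm_mul, mul_pow, ← Finset.mul_sum, h2, timeWeight, Complex.norm_real,
      Real.norm_eq_abs, sq_abs]
    linear_combination (-(1 / 2) * ∑ z, ‖G z t‖ ^ 2) * hs
  rw [h3, defect, Finset.mul_sum, Finset.mul_sum, ← Finset.sum_add_distrib, timeWeight]
  refine Finset.sum_le_sum fun z' _ => ?_
  set c := ((Real.sqrt 2 / 2 : ℝ) : ℂ) * ∑ z, hop k t z' z * G z t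
  have h4 : ‖G z' (t + 1)‖ ≤ ‖G z' (t + 1) + c‖ + ‖c‖ := by
    simpa using norm_sub_le (G z' (t + 1) + c) c
  nlinarith [norm_nonneg (G z' (t + 1)), sq_nonneg (‖G z' (t + 1) + c‖ - ‖c‖)]

/-- Iterating once round the cycle from `t₀` gives `255 = 1 + 2 + ⋯ + 2⁷`; the first defect collects
`254 = 2 + 4 + ⋯ + 2⁷`, and later ones less. -/
theorem sum_le_of_cyclic_growth {n d : ZMod 8 → ℝ} (hd : ∀ t, 0 ≤ d t)
    (h : ∀ t, n (t + 1) ≤ 2 * n t + 2 * d t) (t₀ : ZMod 8) :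
    ∑ t, n t ≤ 255 * n t₀ + 254 * ∑ t, d t := by
  have e : ∀ a : ZMod 8 → ℝ, ∑ t, a t = a t₀ + a (t₀ + 1) + a (t₀ + 1 + 1) + a (t₀ + 1 + 1 + 1) +
      a (t₀ + 1 + 1 + 1 + 1) + a (t₀ + 1 + 1 + 1 + 1 + 1) + a (t₀ + 1 + 1 + 1 + 1 + 1 + 1) +
      a (t₀ + 1 + 1 + 1 + 1 + 1 + 1 + 1) := by
    intro a
    rw [← Equiv.sum_comp (Equiv.addLeft t₀) a]
    refine (Fin.sum_univ_eight (fun m : Fin 8 => a (t₀ + (show ZMod 8 from m)))).trans ?_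
    rw [show t₀ + 1 + 1 + 1 + 1 + 1 + 1 + 1 = t₀ + 7 by ring,
      show t₀ + 1 + 1 + 1 + 1 + 1 + 1 = t₀ + 6 by ring, show t₀ + 1 + 1 + 1 + 1 + 1 = t₀ + 5 by ring,
      show t₀ + 1 + 1 + 1 + 1 = t₀ + 4 by ring, show t₀ + 1 + 1 + 1 = t₀ + 3 by ring,
      show t₀ + 1 + 1 = t₀ + 2 by ring, show a t₀ = a (t₀ + 0) by rw [add_zero]]
    rfl
  rw [e, e]
  have h0 := h t₀
  have h1 := h (t₀ + 1)
  have h2 := h (t₀ + 1 + 1)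
  have h3 := h (t₀ + 1 + 1 + 1)
  have h4 := h (t₀ + 1 + 1 + 1 + 1)
  have h5 := h (t₀ + 1 + 1 + 1 + 1 + 1)
  have h6 := h (t₀ + 1 + 1 + 1 + 1 + 1 + 1)
  have d0 := hd t₀
  have d1 := hd (t₀ + 1)
  have d2 := hd (t₀ + 1 + 1)
  have d3 := hd (t₀ + 1 + 1 + 1)
  have d4 := hd (t₀ + 1 + 1 + 1 + 1)
  have d5 := hd (t₀ + 1 + 1 + 1 + 1 + 1)
  have d6 := hd (t₀ + 1 + 1 + 1 + 1 + 1 + 1)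
  have d7 := hd (t₀ + 1 + 1 + 1 + 1 + 1 + 1 + 1)
  linarith

theorem momentum_energy_ge (k : ZMod 8) (G : Fin 2 → ZMod 8 → ℂ) (t₀ : ZMod 8) :
    (e1 + 1 / 256) * ∑ t, timeWeight G t ≤
      hopEnergy k G + shiftEnergy k * ∑ t, timeWeight G t + 2 * timeWeight G t₀ := by
  have hn : 0 ≤ ∑ t, timeWeight G t := Finset.sum_nonneg fun t _ => timeWeight_nonneg G t
  have hn0 := timeWeight_nonneg G t₀
  have hs : (1.414 : ℝ) ≤ Real.sqrt 2 := Real.le_sqrt_of_sq_le (by norm_num)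
  by_cases hk : k = 1 ∨ k = 7
  · have hD : 0 ≤ ∑ t, defect k G t := Finset.sum_nonneg fun t _ => defect_nonneg k G t
    have h1 : hopEnergy k G =
        Real.sqrt 2 * (∑ t, defect k G t - ∑ t, timeWeight G t - ∑ t, timeWeight G t) := by
      simp only [hopEnergy, sqrt_two_mul_defect hk]
      rw [← Finset.mul_sum, Finset.sum_sub_distrib, Finset.sum_sub_distrib, sum_timeWeight_add_one]
    have h2 := sum_le_of_cyclic_growth (defect_nonneg k G) (timeWeight_add_one_le hk G) t₀
    rw [h1, shiftEnergy_of_eq hk, e1]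
    -- The energy above `e1` is `√2` times the total defect. Since `254/256 < √2` and `255/256 < 2`,
    -- defect and penalty together pay for `1/256` of the weight.
    nlinarith [mul_nonneg (by linarith : 0 ≤ Real.sqrt 2 - 1) hD]
  -- At other momenta the energy is at least `-4 - 1 = -5` per unit weight, already above `e1 +
  -- 1/256`; no penalty is needed.
  · have h1 := neg_four_mul_le_hopEnergy k G
    have h2 := mul_le_mul_of_nonneg_right (neg_one_le_shiftEnergy hk) hn
    rw [e1]
    nlinarith [mul_nonneg (by linarith : 0 ≤ Real.sqrt 2 - 1.414) hn]

end Momentum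

/-! ### From momentum sectors back to `adjG0` -/

section AdjG0

open ZMod

-- The three relations change `t` by `1`, `-1` and `0`, distinct modulo `8`, so no edge is counted
-- twice.
open Classical in
theorem adjG0_apply (v w : G0Vertex) : adjG0 v w =
    (if G0Step v w then 1 else 0) + (if G0Step w v then 1 else 0) +
      if G0Shift v w then 1 else 0 := by
  have ht : ∀ a : ZMod 8, a ≠ a + 1 ∧ a ≠ a + 1 + 1 := by decide
  have h12 : G0Step v w → ¬ G0Step w v := fun h h' => (ht _).2 (h'.1.trans (by rw [h.1]))
  have h13 : G0Step v w → ¬ G0Shift v w := fun h h' => (ht _).1 (h'.2.1.symm.trans h.1)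
  have h23 : G0Step w v → ¬ G0Shift v w := fun h h' => (ht _).1 (h'.2.1.trans h.1)
  have hadj : g0.Adj v w ↔ G0Step v w ∨ G0Step w v ∨ G0Shift v w := Iff.rfl
  rw [adjG0, SimpleGraph.adjMatrix_apply]
  simp only [hadj]
  by_cases h1 : G0Step v w
  · simp [h1, h12 h1, h13 h1]
  · by_cases h2 : G0Step w v
    · simp [h1, h2, h23 h2]
    · simp [h1, h2]

open Classical in
theorem adjG0_comm (v w : G0Vertex) : adjG0 w v = adjG0 v w :=
  (g0.isSymm_adjMatrix (α := ℂ)).apply v w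

theorem adjG0_isHermitian : adjG0.IsHermitian := by
  ext v w
  rw [Matrix.conjTranspose_apply, adjG0_comm]
  simp only [adjG0, SimpleGraph.adjMatrix_apply]
  split_ifs <;> simp

theorem norm_adjG0_le (v w : G0Vertex) : ‖adjG0 v w‖ ≤ 1 := by
  simp only [adjG0, SimpleGraph.adjMatrix_apply]
  split_ifs <;> simp

open Classical in
theorem sum_ite_step (v : G0Vertex) (F : G0Vertex → ℂ) :
    ∑ w, (if G0Step v w then F w else 0) =
      ∑ z', F (z', v.2.1 + 1, v.2.2 + gateExp v.2.1 z' v.1) := by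
  have h : ∀ w : G0Vertex, (if G0Step v w then F w else 0) =
      if w.2.1 = v.2.1 + 1 then if w.2.2 = v.2.2 + gateExp v.2.1 w.1 v.1 then F w else 0 else 0 :=
    fun w => by
      by_cases hs : G0Step v w
      · rw [if_pos hs, if_pos hs.1, if_pos hs.2]
      · rw [if_neg hs]
        split_ifs with h1 h2
        · exact absurd ⟨h1, h2⟩ hs
        · rfl
        · rfl
  simp only [h, Fintype.sum_prod_type, Finset.sum_ite_eq', Finset.mem_univ, if_true,
    Finset.sum_ite_irrel, Finset.sum_const_zero]

open Classical in
theorem sum_ite_shift (v : G0Vertex) (F : G0Vertex → ℂ) :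
    ∑ w, (if G0Shift v w then F w else 0) =
      F (v.1, v.2.1, v.2.2 + 3) + F (v.1, v.2.1, v.2.2 + 4) + F (v.1, v.2.1, v.2.2 + 5) := by
  have h34 : ∀ j : ZMod 8, j + 3 ≠ j + 4 ∧ j + 3 ≠ j + 5 ∧ j + 4 ≠ j + 5 := by decide
  obtain ⟨h1, h2, h3⟩ := h34 v.2.2
  have h : ∀ w : G0Vertex, (if G0Shift v w then F w else 0) =
      if w.1 = v.1 then if w.2.1 = v.2.1 then (if w.2.2 = v.2.2 + 3 then F w else 0) +
        (if w.2.2 = v.2.2 + 4 then F w else 0) + (if w.2.2 = v.2.2 + 5 then F w else 0)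
        else 0 else 0 := by
    intro w
    by_cases hs : G0Shift v w
    · rw [if_pos hs]
      obtain ⟨hz, ht, a3 | a4 | a5⟩ := hs
      · rw [if_pos hz, if_pos ht, if_pos a3, if_neg (a3 ▸ h1), if_neg (a3 ▸ h2), add_zero, add_zero]
      · rw [if_pos hz, if_pos ht, if_neg (a4 ▸ h1.symm), if_pos a4, if_neg (a4 ▸ h3), add_zero,
          zero_add]
      · rw [if_pos hz, if_pos ht, if_neg (a5 ▸ h2.symm), if_neg (a5 ▸ h3.symm), if_pos a5, zero_add,
          zero_add]
    · rw [if_neg hs]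
      by_cases hz : w.1 = v.1
      · by_cases ht : w.2.1 = v.2.1
        · rw [if_pos hz, if_pos ht, if_neg fun a => hs ⟨hz, ht, Or.inl a⟩,
            if_neg fun a => hs ⟨hz, ht, Or.inr (Or.inl a)⟩,
            if_neg fun a => hs ⟨hz, ht, Or.inr (Or.inr a)⟩, add_zero, add_zero]
        · rw [if_pos hz, if_neg ht]
      · rw [if_neg hz]
  simp only [h, Fintype.sum_prod_type, Finset.sum_ite_eq', Finset.mem_univ, if_true,
    Finset.sum_ite_irrel, Finset.sum_const_zero, Finset.sum_add_distrib]

/-- The Fourier components of a state of `g₀`. -/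
def momentumState (f : G0Vertex → ℂ) (k : ZMod 8) (z : Fin 2) (t : ZMod 8) : ℂ :=
  fourier (fun j => f (z, t, j)) k

theorem sum_timeWeight_momentumState (f : G0Vertex → ℂ) (t : ZMod 8) :
    ∑ k, timeWeight (momentumState f k) t = 8 * ∑ z, ∑ j, ‖f (z, t, j)‖ ^ 2 := by
  simp only [timeWeight, momentumState]
  rw [Finset.sum_comm, Finset.mul_sum]
  exact Finset.sum_congr rfl fun z _ => sum_norm_sq_fourier _

-- All terms of `adjG0` are translation invariant in `j`, so the form is a sum over momenta; the `8`
-- is Parseval's factor. Backward steps are conjugates of forward ones, hence the `2` in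
-- `hopEnergy`.
open Classical in
theorem quadForm_adjG0 (f : G0Vertex → ℂ) :
    8 * quadForm adjG0 f = ∑ k, (hopEnergy k (momentumState f k) +
      shiftEnergy k * ∑ t, timeWeight (momentumState f k) t) := by
  have h1 : (∑ v, ∑ w, star (f w) * (adjG0 w v * f v)) =
      ∑ v, ∑ w, (if G0Step v w then star (f w) * f v else 0) +
      ∑ v, ∑ w, (if G0Step w v then star (f w) * f v else 0) +
      ∑ v, ∑ w, (if G0Shift v w then star (f w) * f v else 0) := by
    simp only [← Finset.sum_add_distrib]
    refine Finset.sum_congr rfl fun v _ => Finset.sum_congr rfl fun w _ => ?_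
    rw [adjG0_comm, adjG0_apply]
    split_ifs <;> ring
  have h2 : (∑ v, ∑ w, (if G0Step w v then star (f w) * f v else 0)).re =
      (∑ v, ∑ w, (if G0Step v w then star (f w) * f v else 0)).re := by
    rw [Finset.sum_comm]
    simp only [Complex.re_sum]
    refine Finset.sum_congr rfl fun v _ => Finset.sum_congr rfl fun w _ => ?_
    split_ifs
    · simp [mul_comm]
    · rfl
  have h0 : quadForm adjG0 f = (∑ v, ∑ w, star (f w) * (adjG0 w v * f v)).re := by
    rw [quadForm_eq_sum, Finset.sum_comm]
    simp only [Complex.re_sum]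
  have h3 : 8 * ∑ v, ∑ w, (if G0Step v w then star (f w) * f v else 0) =
      ∑ k, ∑ t, ∑ z, ∑ z', hop k t z' z *
        (star (momentumState f k z' (t + 1)) * momentumState f k z t) := by
    simp only [sum_ite_step]
    rw [Fintype.sum_prod_type]
    simp only [Fintype.sum_prod_type]
    rw [Finset.sum_comm, Finset.mul_sum, Finset.sum_comm (γ := ZMod 8)]
    refine Finset.sum_congr rfl fun t _ => ?_
    rw [Finset.mul_sum, Finset.sum_comm (γ := ZMod 8)]
    refine Finset.sum_congr rfl fun z _ => ?_
    rw [Finset.sum_comm, Finset.mul_sum, Finset.sum_comm (γ := ZMod 8)]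
    refine Finset.sum_congr rfl fun z' _ => ?_
    exact sum_star_shift_mul (fun j => f (z', t + 1, j)) (fun j => f (z, t, j)) (gateExp t z' z)
  have h4 : 8 * ∑ v, ∑ w, (if G0Shift v w then star (f w) * f v else 0) =
      ∑ k, ∑ t, ∑ z, (stdAddChar (k * 3) + stdAddChar (k * 4) + stdAddChar (k * 5)) *
        (star (momentumState f k z t) * momentumState f k z t) := by
    simp only [sum_ite_shift]
    rw [Fintype.sum_prod_type]
    simp only [Fintype.sum_prod_type]
    rw [Finset.sum_comm, Finset.mul_sum, Finset.sum_comm (γ := ZMod 8)]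
    refine Finset.sum_congr rfl fun t _ => ?_
    rw [Finset.mul_sum, Finset.sum_comm (γ := ZMod 8)]
    refine Finset.sum_congr rfl fun z _ => ?_
    simp only [add_mul, Finset.sum_add_distrib, mul_add]
    have := sum_star_shift_mul (fun j => f (z, t, j)) (fun j => f (z, t, j))
    rw [this 3, this 4, this 5]
    rfl
  rw [h0, h1, Complex.add_re, Complex.add_re, h2]
  have h3' := congrArg Complex.re h3
  have h4' := congrArg Complex.re h4
  rw [show (8 : ℂ) = ((8 : ℝ) : ℂ) by norm_num, Complex.re_ofReal_mul] at h3' h4'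
  rw [show ∀ a b : ℝ, 8 * (a + a + b) = 2 * (8 * a) + 8 * b by intros; ring, h3', h4',
    Finset.sum_add_distrib]
  congr 1
  · simp only [hopEnergy, Complex.re_sum, Finset.mul_sum]
  · simp only [Complex.re_sum, timeWeight, Finset.mul_sum]
    refine Finset.sum_congr rfl fun k _ => Finset.sum_congr rfl fun t _ =>
      Finset.sum_congr rfl fun z _ => ?_
    rw [RCLike.star_def, Complex.conj_mul', ← Complex.ofReal_pow, Complex.re_mul_ofReal]
    rfl

/-- The smallest eigenvalue of `A(g₀)` is raised above `e₁` by a penalty at any single time. -/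
theorem quadForm_adjG0_add_ge (f : G0Vertex → ℂ) (t₀ : ZMod 8) :
    (e1 + 1 / 256) * normSq f ≤ quadForm adjG0 f + 2 * ∑ z, ∑ j, ‖f (z, t₀, j)‖ ^ 2 := by
  have h := Finset.sum_le_sum fun k (_ : k ∈ Finset.univ) =>
    momentum_energy_ge k (momentumState f k) t₀
  rw [Finset.sum_add_distrib, ← quadForm_adjG0, ← Finset.mul_sum, ← Finset.mul_sum,
    sum_timeWeight_momentumState, Finset.sum_comm] at h
  simp only [sum_timeWeight_momentumState] at h
  have hn : normSq f = ∑ t, ∑ z, ∑ j, ‖f (z, t, j)‖ ^ 2 := by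
    rw [normSq, Fintype.sum_prod_type]
    simp only [Fintype.sum_prod_type]
    rw [Finset.sum_comm]
  rw [← Finset.mul_sum, ← hn] at h
  linarith

end AdjG0

/-! ### Spectra of gate graphs -/

section Spectra

variable {ι : Type*} [Fintype ι]

theorem mem_eigenvalues_sub_smul_one [DecidableEq ι] {M : Matrix ι ι ℂ} {c x : ℝ} :
    x ∈ eigenvalues (M - (c : ℂ) • 1) ↔ x + c ∈ eigenvalues M := by
  simp only [eigenvalues, eigenvaluesOn, Set.mem_ofPred_eq, Matrix.sub_mulVec, Matrix.smul_mulVec,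
    Matrix.one_mulVec, sub_eq_iff_eq_add, Complex.ofReal_add, add_smul]

/-- Read the eigenvalue equation at a coordinate of maximal modulus. -/
theorem eigenvalue_le_of_sum_norm_le {M : Matrix ι ι ℂ} {K x : ℝ} (hM : ∀ i, ∑ j, ‖M i j‖ ≤ K)
    (hx : x ∈ eigenvalues M) : x ≤ K := by
  obtain ⟨v, -, hv0, hv⟩ := hx
  obtain ⟨i₀, hi₀⟩ := Function.ne_iff.mp hv0
  obtain ⟨i, -, hi⟩ := Finset.exists_max_image Finset.univ (fun i => ‖v i‖) ⟨i₀, Finset.mem_univ _⟩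
  have hpos : 0 < ‖v i‖ := (norm_pos_iff.mpr hi₀).trans_le (hi i₀ (Finset.mem_univ _))
  have h1 : ‖(x : ℂ) * v i‖ ≤ K * ‖v i‖ := by
    rw [show (x : ℂ) * v i = M.mulVec v i by rw [hv]; rfl, Matrix.mulVec, dotProduct]
    calc ‖∑ j, M i j * v j‖ ≤ ∑ j, ‖M i j‖ * ‖v i‖ := by
          refine (norm_sum_le _ _).trans (Finset.sum_le_sum fun j _ => ?_)
          rw [norm_mul]
          exact mul_le_mul_of_nonneg_left (hi j (Finset.mem_univ _)) (norm_nonneg _)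
      _ ≤ K * ‖v i‖ := by
          rw [← Finset.sum_mul]
          exact mul_le_mul_of_nonneg_right (hM i) hpos.le
  rw [norm_mul, Complex.norm_real] at h1
  exact (le_abs_self x).trans (le_of_mul_le_mul_right h1 hpos)

theorem quadForm_one_kronecker {κ : Type*} [Fintype κ] [DecidableEq κ] (M : Matrix ι ι ℂ)
    (v : κ × ι → ℂ) :
    quadForm ((1 : Matrix κ κ ℂ) ⊗ₖ M) v = ∑ q, quadForm M fun u => v (q, u) := by
  simp only [quadForm_eq_sum, Fintype.sum_prod_type, Matrix.kroneckerMap_apply, Matrix.one_apply]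
  refine Finset.sum_congr rfl fun q _ => Finset.sum_congr rfl fun u _ => ?_
  rw [Finset.sum_eq_single q]
  · simp
  · intro b _ hb
    simp [hb.symm]
  · simp

end Spectra

namespace GateDiagram

variable {R : ℕ} (D : GateDiagram R)

theorem quadForm_hS_nonneg (v : Vertex R → ℂ) : 0 ≤ quadForm D.hS v := by
  classical
  have h : D.hS = Matrix.diagonal fun v =>
      ((if Vertex.node v ∈ D.loops then 1 else 0 : ℝ) : ℂ) := by
    simp only [hS]
    congr 1
    funext v
    split_ifs <;> simp
  rw [h, quadForm_diagonal]
  refine Finset.sum_nonneg fun v _ => mul_nonneg ?_ (by positivity)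
  split_ifs <;> norm_num

/-- For each edge and each `j` the term has rank one: the squared modulus of the sum of the
amplitudes at the two endpoints. -/
theorem quadForm_hE_nonneg (v : Vertex R → ℂ) : 0 ≤ quadForm D.hE v := by
  classical
  rw [hE, quadForm_sum]
  refine Finset.sum_nonneg fun e _ => ?_
  have h : quadForm (Matrix.of fun v w : Vertex R =>
      if Vertex.node v ∈ e ∧ Vertex.node w ∈ e ∧ v.2.2.2 = w.2.2.2 then (1 : ℂ) else 0) v =
      ∑ j : ZMod 8, ‖∑ w : Vertex R, if Vertex.node w ∈ e ∧ w.2.2.2 = j then v w else 0‖ ^ 2 := by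
    have h1 : ∀ j : ZMod 8,
        ‖∑ w : Vertex R, if Vertex.node w ∈ e ∧ w.2.2.2 = j then v w else 0‖ ^ 2 =
        ∑ u : Vertex R, ∑ w : Vertex R, (star (if Vertex.node u ∈ e ∧ u.2.2.2 = j then v u else 0) *
          (if Vertex.node w ∈ e ∧ w.2.2.2 = j then v w else 0)).re := by
      intro j
      set g : Vertex R → ℂ := fun w => if Vertex.node w ∈ e ∧ w.2.2.2 = j then v w else 0
      have h2 : ((‖∑ w, g w‖ ^ 2 : ℝ) : ℂ) = ∑ u, ∑ w, star (g u) * g w := by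
        rw [← Finset.sum_mul_sum, ← star_sum, RCLike.star_def, Complex.conj_mul',
          Complex.ofReal_pow]
      have h3 := congrArg Complex.re h2
      simpa only [Complex.ofReal_re, Complex.re_sum] using h3
    simp only [h1, quadForm_eq_sum]
    symm
    rw [Finset.sum_comm]
    refine Finset.sum_congr rfl fun u _ => ?_
    rw [Finset.sum_comm]
    refine Finset.sum_congr rfl fun w _ => ?_
    rw [Finset.sum_eq_single u.2.2.2]
    · by_cases hu : Vertex.node u ∈ e <;> by_cases hw : Vertex.node w ∈ e <;>
        by_cases hj : u.2.2.2 = w.2.2.2 <;> simp [hu, hw, hj, eq_comm]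
    · intro j _ hj
      simp [hj.symm]
    · simp
  rw [h]
  exact Finset.sum_nonneg fun _ _ => by positivity

theorem adj_isHermitian : D.adj.IsHermitian := by
  classical
  refine (Matrix.IsHermitian.add ?_ ?_).add ?_
  · rw [Matrix.IsHermitian, Matrix.conjTranspose_kronecker, adjG0_isHermitian.eq,
      Matrix.conjTranspose_one]
  · refine Matrix.isHermitian_diagonal_of_self_adjoint _ ?_
    funext v
    simp only [Pi.star_apply]
    split_ifs <;> simp
  · refine isSelfAdjoint_sum _ fun e _ => ?_
    ext v w
    simp only [Matrix.star_apply, Matrix.of_apply]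
    by_cases hv : Vertex.node v ∈ e <;> by_cases hw : Vertex.node w ∈ e <;>
      by_cases hj : v.2.2.2 = w.2.2.2 <;> simp [hv, hw, hj, eq_comm]

/-- By `edge_unique` at most one edge meets the node of `v`, and only its two endpoints at the same
`j` contribute. -/
theorem sum_norm_hE_le (v : Vertex R) : ∑ w, ‖D.hE v w‖ ≤ 2 := by
  classical
  by_cases hv : ∃ e ∈ D.edges, Vertex.node v ∈ e
  · obtain ⟨e, he, hve⟩ := hv
    have h : ∀ w, D.hE v w = if Vertex.node w ∈ e ∧ v.2.2.2 = w.2.2.2 then 1 else 0 := by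
      intro w
      rw [hE, Matrix.sum_apply, Finset.sum_eq_single e]
      · simp [hve]
      · intro e' he' hne
        simp only [Matrix.of_apply]
        rw [if_neg fun h => hne (D.edge_unique e' he' e he _ h.1 hve)]
      · exact fun h => absurd he h
    induction e using Sym2.ind with | _ a b =>
    have hle : ∀ w, ‖D.hE v w‖ ≤ (if w = (a.1, a.2.1, a.2.2, v.2.2.2) then (1 : ℝ) else 0) +
        if w = (b.1, b.2.1, b.2.2, v.2.2.2) then 1 else 0 := by
      rintro ⟨q, z, t, j⟩
      rw [h]
      by_cases hw : Vertex.node (q, z, t, j) ∈ s(a, b) ∧ v.2.2.2 = j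
      · obtain ⟨hab, hj⟩ := hw
        rcases Sym2.mem_iff.mp hab with hab | hab
        · subst hab
          rw [if_pos (show ((q, z, t, j) : Vertex R) = _ by rw [hj]; rfl)]
          split_ifs <;> norm_num
        · subst hab
          rw [if_pos (show ((q, z, t, j) : Vertex R) =
            ((Vertex.node (q, z, t, j)).1, _, _, _) by rw [hj]; rfl)]
          split_ifs <;> norm_num
      · rw [if_neg hw, norm_zero]
        positivity
    refine (Finset.sum_le_sum fun w _ => hle w).trans ?_
    rw [Finset.sum_add_distrib]
    simp
    norm_num
  · push Not at hv
    have h : ∀ w, D.hE v w = 0 := by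
      intro w
      rw [hE, Matrix.sum_apply]
      refine Finset.sum_eq_zero fun e he => ?_
      simp [hv e he]
    simp [h]

theorem sum_norm_adj_le (v : Vertex R) : ∑ w, ‖D.adj v w‖ ≤ 131 := by
  classical
  have h1 : ∑ w, ‖((1 : Matrix (Fin R) (Fin R) ℂ) ⊗ₖ adjG0) v w‖ ≤ 128 := by
    rw [Fintype.sum_prod_type, Finset.sum_eq_single v.1]
    · refine (Finset.sum_le_sum (g := fun _ => (1 : ℝ)) fun u _ => ?_).trans ?_
      · simpa using norm_adjG0_le v.2 u
      · simp [Fintype.card_prod, ZMod.card]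
    · intro q _ hq
      simp [Matrix.kroneckerMap_apply, hq.symm]
    · simp
  have h2 : ∑ w, ‖D.hS v w‖ ≤ 1 := by
    rw [Finset.sum_eq_single v]
    · simp only [hS, Matrix.diagonal_apply_eq]
      split_ifs <;> simp
    · intro w _ hw
      simp [hS, Matrix.diagonal_apply_ne' _ hw]
    · simp
  have h3 := D.sum_norm_hE_le v
  calc ∑ w, ‖D.adj v w‖ ≤ ∑ w, (‖((1 : Matrix (Fin R) (Fin R) ℂ) ⊗ₖ adjG0) v w‖ + ‖D.hS v w‖ +
        ‖D.hE v w‖) := Finset.sum_le_sum fun w _ => norm_add₃_le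
    _ ≤ 131 := by
      rw [Finset.sum_add_distrib, Finset.sum_add_distrib]
      linarith

theorem eigenvalues_adj_sub_le {x : ℝ} (hx : x ∈ eigenvalues (D.adj - (e1 : ℂ) • 1)) :
    x ≤ 140 := by
  have h := eigenvalue_le_of_sum_norm_le D.sum_norm_adj_le (mem_eigenvalues_sub_smul_one.mp hx)
  have hs : Real.sqrt 2 ≤ 2 := Real.sqrt_le_iff.mpr ⟨by norm_num, by norm_num⟩
  rw [e1] at h
  linarith

/-- Supplies, in each element, a time at which the penalty `Π_𝒩` acts on every `z` and `j`. -/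
theorem _root_.BoseHubbard.UnitaryLabel.exists_notMem_times (l : UnitaryLabel) :
    ∃ t, t ∉ l.times := by
  cases l
  · exact ⟨2, by simp only [UnitaryLabel.times, Set.mem_insert_iff, Set.mem_singleton_iff]; decide⟩
  · exact ⟨4, by simp only [UnitaryLabel.times, Set.mem_insert_iff, Set.mem_singleton_iff]; decide⟩
  · exact ⟨2, by simp only [UnitaryLabel.times, Set.mem_insert_iff, Set.mem_singleton_iff]; decide⟩

variable {D} in
theorem mem_noLoop_of_notMem_times {q : Fin R} {t : ZMod 8} (ht : t ∉ (D.label q).times)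
    (z : Fin 2) (j : ZMod 8) : ((q, z, t, j) : Vertex R) ∈ D.noLoop :=
  ⟨fun h => ht (D.loops_appear _ h), fun _ h => ht (D.edges_appear _ h _ (Sym2.mem_mk_left _ _))⟩

/-- On the vertices without self-loop or edge, a penalty lifts the spectrum of `A(G)` above `e₁` by
a constant. -/
theorem quadForm_adj_add_projNoLoop_ge (v : Vertex R → ℂ) :
    (e1 + 1 / 256) * normSq v ≤ quadForm (D.adj + (2 : ℂ) • D.projNoLoop) v := by
  classical
  choose t ht using fun q => (D.label q).exists_notMem_times
  have h2 : (2 : ℂ) = ((2 : ℝ) : ℂ) := by norm_num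
  have hproj : D.projNoLoop = Matrix.diagonal fun v =>
      ((if v ∈ D.noLoop then 1 else 0 : ℝ) : ℂ) := by
    simp only [projNoLoop]
    congr 1
    funext v
    split_ifs <;> simp
  have hp : ∑ q, ∑ z, ∑ j, ‖v (q, z, t q, j)‖ ^ 2 ≤ quadForm D.projNoLoop v := by
    rw [hproj, quadForm_diagonal, Fintype.sum_prod_type]
    refine Finset.sum_le_sum fun q _ => ?_
    rw [Fintype.sum_prod_type]
    refine Finset.sum_le_sum fun z _ => ?_
    rw [Fintype.sum_prod_type]
    refine le_trans ?_ (Finset.single_le_sum (fun s _ => Finset.sum_nonneg fun j _ =>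
      mul_nonneg (by split_ifs <;> norm_num) (by positivity)) (Finset.mem_univ (t q)))
    refine Finset.sum_le_sum fun j _ => ?_
    rw [if_pos (mem_noLoop_of_notMem_times (ht q) z j), one_mul]
  have hg : ∑ q, (e1 + 1 / 256) * normSq (fun u => v (q, u)) ≤
      ∑ q, (quadForm adjG0 (fun u => v (q, u)) + 2 * ∑ z, ∑ j, ‖v (q, z, t q, j)‖ ^ 2) :=
    Finset.sum_le_sum fun q _ => quadForm_adjG0_add_ge (fun u => v (q, u)) (t q)
  have hn : normSq v = ∑ q, normSq fun u => v (q, u) := by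
    simp only [normSq]
    exact Fintype.sum_prod_type _
  rw [Finset.sum_add_distrib, ← Finset.mul_sum, ← Finset.mul_sum, ← hn] at hg
  rw [h2, quadForm_add, quadForm_smul, adj, quadForm_add, quadForm_add, quadForm_one_kronecker]
  have := D.quadForm_hS_nonneg v
  have := D.quadForm_hE_nonneg v
  linarith

/-! ### The doubled graph -/

theorem projPlus_apply (a b : Fin 2) : projPlus a b = 1 / 2 := by
  fin_cases a <;> fin_cases b <;> simp [projPlus]

/-- All entries of `2 Π₊` are `1`, so the penalty sees only the sum of the two copies. -/
theorem adjSL_mulVec (v : Vertex R × Fin 2 → ℂ) (u : Vertex R) (d : Fin 2) :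
    D.adjSL.mulVec v (u, d) = D.adj.mulVec (fun w => v (w, d)) u +
      D.projNoLoop.mulVec (fun w => v (w, 0) + v (w, 1)) u := by
  simp only [adjSL, Matrix.add_mulVec, Matrix.smul_mulVec, Pi.add_apply, Pi.smul_apply]
  congr 1
  · simp only [Matrix.mulVec, dotProduct, Fintype.sum_prod_type, Matrix.kroneckerMap_apply,
      Matrix.one_apply, mul_ite, mul_one, mul_zero, ite_mul, zero_mul, Finset.sum_ite_eq,
      Finset.mem_univ, if_true]
  · rw [Matrix.mulVec, dotProduct, Fintype.sum_prod_type, Matrix.mulVec, dotProduct, smul_eq_mul,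
      Finset.mul_sum]
    simp only [Matrix.kroneckerMap_apply, projPlus_apply, Fin.sum_univ_two]
    refine Finset.sum_congr rfl fun w _ => ?_
    ring

theorem adjSL_mulVec_antisymm (v : Vertex R → ℂ) (u : Vertex R) (d : Fin 2) :
    D.adjSL.mulVec (fun w => (-1) ^ (w.2 : ℕ) * v w.1) (u, d) =
      (-1) ^ (d : ℕ) * D.adj.mulVec v u := by
  rw [adjSL_mulVec]
  have h0 : (fun w => (-1 : ℂ) ^ ((0 : Fin 2) : ℕ) * v w + (-1 : ℂ) ^ ((1 : Fin 2) : ℕ) * v w) =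
      0 := by
    funext w; simp
  have h1 : (fun w => (-1 : ℂ) ^ (d : ℕ) * v w) = (-1 : ℂ) ^ (d : ℕ) • v := rfl
  simp only [h0, h1, Matrix.mulVec_zero, Matrix.mulVec_smul, Pi.zero_apply, add_zero,
    Pi.smul_apply, smul_eq_mul]

theorem adjSL_isHermitian : D.adjSL.IsHermitian := by
  classical
  have h1 : D.projNoLoop.IsHermitian := by
    refine Matrix.isHermitian_diagonal_of_self_adjoint _ ?_
    funext v
    simp only [Pi.star_apply]
    split_ifs <;> simp
  have h2 : projPlus.IsHermitian := by
    ext a b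
    simp [Matrix.conjTranspose_apply, projPlus_apply]
  refine Matrix.IsHermitian.add ?_ (Matrix.IsHermitian.smul ?_ (by simp [IsSelfAdjoint]))
  · rw [Matrix.IsHermitian, Matrix.conjTranspose_kronecker, D.adj_isHermitian.eq,
      Matrix.conjTranspose_one]
  · rw [Matrix.IsHermitian, Matrix.conjTranspose_kronecker, h1.eq, h2.eq]

variable {D}

/-- An eigenvector of `A(G^SL)` either has eigenvalue at least `e₁ + 1/256` or is antisymmetric in
the last register. -/
theorem eigenvector_adjSL {v : Vertex R × Fin 2 → ℂ} {x : ℝ}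
    (hv : D.adjSL.mulVec v = (x : ℂ) • v) :
    e1 + 1 / 256 ≤ x ∨
      ((∀ w, v (w, 1) = -v (w, 0)) ∧
        D.adj.mulVec (fun w => v (w, 0)) = (x : ℂ) • fun w => v (w, 0)) := by
  -- Adding the equations of the two copies makes `s` an eigenvector of `D.adj + 2 • D.projNoLoop`
  -- unless it vanishes.
  set s : Vertex R → ℂ := fun w => v (w, 0) + v (w, 1) with hs
  have hd : ∀ d u, D.adj.mulVec (fun w => v (w, d)) u + D.projNoLoop.mulVec s u = x * v (u, d) := by
    intro d u
    rw [← adjSL_mulVec, hv]; rfl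
  by_cases h0 : s = 0
  · right
    refine ⟨fun w => eq_neg_of_add_eq_zero_right (congrFun h0 w), funext fun u => ?_⟩
    have := hd 0 u
    rw [h0, Matrix.mulVec_zero] at this
    simpa using this
  · left
    have hse : (D.adj + (2 : ℂ) • D.projNoLoop).mulVec s = (x : ℂ) • s := by
      funext u
      have h1 : D.adj.mulVec s =
          D.adj.mulVec (fun w => v (w, 0)) + D.adj.mulVec (fun w => v (w, 1)) := by
        rw [← Matrix.mulVec_add]; rfl
      simp only [Matrix.add_mulVec, Matrix.smul_mulVec, h1, Pi.add_apply, Pi.smul_apply,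
        smul_eq_mul]
      rw [hs]
      linear_combination hd 0 u + hd 1 u
    have := D.quadForm_adj_add_projNoLoop_ge s
    rw [quadForm_of_mulVec_eq hse] at this
    exact le_of_mul_le_mul_right this (normSq_pos h0)

theorem eigenvalues_adjSL {x : ℝ} (hx : x ∈ eigenvalues D.adjSL) :
    e1 + 1 / 256 ≤ x ∨ x ∈ eigenvalues D.adj := by
  obtain ⟨v, -, hv0, hv⟩ := hx
  refine (eigenvector_adjSL hv).imp_right fun ⟨h1, h2⟩ => ⟨_, trivial, fun h => hv0 ?_, h2⟩
  funext ⟨w, d⟩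
  have h0 := congrFun h w
  fin_cases d
  · exact h0
  · exact (h1 w).trans (by simpa using h0)

theorem IsE1GateGraph.minEigenvalue_adj (hD : D.IsE1GateGraph) : minEigenvalue D.adj = e1 :=
  hD.csInf_eq

theorem IsE1GateGraph.minEigenvalue_adjSL (hD : D.IsE1GateGraph) :
    minEigenvalue D.adjSL = e1 := by
  refine IsLeast.csInf_eq ⟨?_, fun x hx => ?_⟩
  · obtain ⟨v, -, hv0, hv⟩ := hD.1
    refine ⟨fun w => (-1) ^ (w.2 : ℕ) * v w.1, trivial, fun h => hv0 ?_, ?_⟩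
    · funext u
      simpa using congrFun h (u, 0)
    · funext ⟨u, d⟩
      rw [adjSL_mulVec_antisymm, hv]
      simp only [Pi.smul_apply, smul_eq_mul]
      ring
  · rcases eigenvalues_adjSL hx with h | h
    · linarith
    · exact hD.2 h

theorem IsE1GateGraph.nonneg_of_mem_adj (hD : D.IsE1GateGraph) {x : ℝ}
    (hx : x ∈ eigenvalues (D.adj - (e1 : ℂ) • 1)) : 0 ≤ x := by
  have := hD.2 (mem_eigenvalues_sub_smul_one.mp hx)
  linarith

theorem IsE1GateGraph.nonneg_of_mem_adjSL (hD : D.IsE1GateGraph) {x : ℝ}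
    (hx : x ∈ eigenvalues (D.adjSL - (e1 : ℂ) • 1)) : 0 ≤ x := by
  rcases eigenvalues_adjSL (mem_eigenvalues_sub_smul_one.mp hx) with h | h
  · linarith
  · have := hD.2 h
    linarith

theorem IsE1GateGraph.gap_le (hD : D.IsE1GateGraph) {x : ℝ}
    (hx : x ∈ eigenvalues (D.adj - (e1 : ℂ) • 1)) (hx0 : x ≠ 0) :
    gap (D.adj - (e1 : ℂ) • 1) ≤ x :=
  csInf_le ⟨0, fun _ hy => hD.nonneg_of_mem_adj hy.1⟩ ⟨hx, hx0⟩

/-- An absolute upper bound on the gap lets `min γ (1/256)` be bounded below by a constant multiple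
of `γ`. -/
theorem IsE1GateGraph.gap_le_const (hD : D.IsE1GateGraph) :
    gap (D.adj - (e1 : ℂ) • 1) ≤ 140 := by
  rcases Set.eq_empty_or_nonempty
    {x | x ∈ eigenvalues (D.adj - (e1 : ℂ) • 1) ∧ x ≠ 0} with h | ⟨x, hx, hx0⟩
  -- Without nonzero eigenvalues `gap` takes the default value `0`.
  · rw [gap, h, Real.sInf_empty]; norm_num
  · exact (hD.gap_le hx hx0).trans (D.eigenvalues_adj_sub_le hx)

theorem IsE1GateGraph.min_gap_le (hD : D.IsE1GateGraph) {x : ℝ}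
    (hx : x ∈ eigenvalues (D.adjSL - (e1 : ℂ) • 1)) (hx0 : x ≠ 0) :
    min (gap (D.adj - (e1 : ℂ) • 1)) (1 / 256) ≤ x := by
  rcases eigenvalues_adjSL (mem_eigenvalues_sub_smul_one.mp hx) with h | h
  · exact (min_le_right _ _).trans (by linarith)
  · exact (min_le_left _ _).trans (hD.gap_le (mem_eigenvalues_sub_smul_one.mpr h) hx0)

end GateDiagram

/-! ### States that are antisymmetric in every second register -/

section AntisymLift

variable {V : Type*} {N : ℕ}

/-- The state `φ ⊗ (|0⟩ - |1⟩)^{⊗N}`. -/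
def antisymLift (φ : (Fin N → V) → ℂ) (X : Fin N → V × Fin 2) : ℂ :=
  (∏ i, (-1) ^ ((X i).2 : ℕ)) * φ fun i => (X i).1

theorem norm_sign (X : Fin N → V × Fin 2) : ‖∏ i, (-1 : ℂ) ^ ((X i).2 : ℕ)‖ = 1 := by
  simp [norm_prod]

theorem norm_antisymLift (φ : (Fin N → V) → ℂ) (X : Fin N → V × Fin 2) :
    ‖antisymLift φ X‖ = ‖φ fun i => (X i).1‖ := by
  rw [antisymLift, norm_mul, norm_sign, one_mul]

theorem antisymLift_update [DecidableEq V] (φ : (Fin N → V) → ℂ) (X : Fin N → V × Fin 2) (i : Fin N)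
    (a : V × Fin 2) : antisymLift φ (Function.update X i a) =
      (∏ j ∈ Finset.univ.erase i, (-1) ^ ((X j).2 : ℕ)) *
        ((-1) ^ (a.2 : ℕ) * φ (Function.update (fun j => (X j).1) i a.1)) := by
  rw [antisymLift, ← Finset.mul_prod_erase _ _ (Finset.mem_univ i), Function.update_self]
  have h1 : ∏ j ∈ Finset.univ.erase i, (-1 : ℂ) ^ ((Function.update X i a j).2 : ℕ) =
      ∏ j ∈ Finset.univ.erase i, (-1 : ℂ) ^ ((X j).2 : ℕ) :=
    Finset.prod_congr rfl fun j hj => by rw [Function.update_of_ne (Finset.ne_of_mem_erase hj)]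
  have h2 : (fun j => (Function.update X i a j).1) = Function.update (fun j => (X j).1) i a.1 := by
    funext j
    by_cases h : j = i
    · subst h; simp
    · simp [Function.update_of_ne h]
  rw [h1, h2]
  ring

variable [Fintype V]

theorem sum_eq_sum_sum_pair {β : Type*} [AddCommMonoid β] (F : (Fin N → V × Fin 2) → β) :
    ∑ X, F X = ∑ x : Fin N → V, ∑ d : Fin N → Fin 2, F fun i => (x i, d i) := by
  rw [← Fintype.sum_prod_type'
    (f := fun (x : Fin N → V) (d : Fin N → Fin 2) => F fun i => (x i, d i))]
  exact Fintype.sum_equiv (Equiv.arrowProdEquivProdArrow _ _ _) _ _ fun X => rfl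

theorem sum_lift_const {β : Type*} [AddCommMonoid β] (F : (Fin N → V) → β) :
    ∑ X : Fin N → V × Fin 2, F (fun i => (X i).1) = 2 ^ N • ∑ x, F x := by
  rw [sum_eq_sum_sum_pair]
  simp [Finset.smul_sum]

theorem normSq_antisymLift (φ : (Fin N → V) → ℂ) :
    normSq (antisymLift φ) = 2 ^ N * normSq φ := by
  simp only [normSq, norm_antisymLift]
  rw [sum_lift_const fun x => ‖φ x‖ ^ 2]
  simp

variable [DecidableEq V]

theorem antisymLift_mem_bosonicSpace {φ : (Fin N → V) → ℂ} (hφ : φ ∈ bosonicSpace V N) :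
    antisymLift φ ∈ bosonicSpace (V × Fin 2) N := by
  rw [mem_bosonicSpace_iff] at hφ ⊢
  intro p X
  simp only [antisymLift, Function.comp_apply]
  rw [Equiv.prod_comp p fun i => (-1 : ℂ) ^ ((X i).2 : ℕ)]
  congr 1
  exact hφ p fun i => (X i).1

/-- Flipping the bit `d i` exchanges the assignments with `d i = d j` and those with `d i ≠ d j`. -/
theorem two_mul_sum_ite_eq {i j : Fin N} (hij : i ≠ j) :
    2 * ∑ d : Fin N → Fin 2, (if d i = d j then (1 : ℝ) else 0) = 2 ^ N := by
  have hinv : Function.Involutive fun d : Fin N → Fin 2 => Function.update d i (d i + 1) := by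
    intro d
    have : ∀ a : Fin 2, a + 1 + 1 = a := by decide
    simp [this]
  have h1 := Equiv.sum_comp (hinv.toPerm _) fun d : Fin N → Fin 2 =>
    if d i = d j then (1 : ℝ) else 0
  have h2 : ∑ d : Fin N → Fin 2, ((if d i = d j then (1 : ℝ) else 0) +
      if (hinv.toPerm _ d) i = (hinv.toPerm _ d) j then (1 : ℝ) else 0) = 2 ^ N := by
    have : ∀ d : Fin N → Fin 2, ((if d i = d j then (1 : ℝ) else 0) +
        if (hinv.toPerm _ d) i = (hinv.toPerm _ d) j then (1 : ℝ) else 0) = 1 := by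
      intro d
      have h : ∀ a b : Fin 2, a + 1 = b ↔ a ≠ b := by decide
      simp only [Function.Involutive.coe_toPerm, Function.update_self,
        Function.update_of_ne hij.symm, h]
      by_cases hd : d i = d j <;> simp [hd]
    rw [Finset.sum_congr rfl fun d _ => this d]
    simp
  rw [Finset.sum_add_distrib, h1] at h2
  linarith

omit [Fintype V] in
theorem two_mul_sum_collisions (x : Fin N → V) :
    2 * ∑ d : Fin N → Fin 2, collisions (fun i => (x i, d i)) = 2 ^ N * collisions x := by
  simp only [collisions]
  rw [Finset.sum_comm, Finset.mul_sum, Finset.mul_sum]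
  refine Finset.sum_congr rfl fun i _ => ?_
  rw [Finset.sum_comm, Finset.mul_sum, Finset.mul_sum]
  refine Finset.sum_congr rfl fun j _ => ?_
  by_cases h : i ≠ j ∧ x i = x j
  · simp only [Prod.mk.injEq, h.1, h.2, ne_eq, not_false_eq_true, true_and, if_true, mul_one]
    exact two_mul_sum_ite_eq h.1
  · rw [if_neg h, mul_zero]
    simp only [Prod.mk.injEq, ← and_assoc]
    simp [h]

/-- The modulus of the lift ignores the second registers. Relative to `normSq_antisymLift`, the
interaction energy per unit norm is exactly halved. -/
theorem two_mul_sum_collisions_antisymLift (φ : (Fin N → V) → ℂ) :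
    2 * ∑ X, collisions X * ‖antisymLift φ X‖ ^ 2 = 2 ^ N * ∑ x, collisions x * ‖φ x‖ ^ 2 := by
  simp only [norm_antisymLift]
  rw [sum_eq_sum_sum_pair, Finset.mul_sum, Finset.mul_sum]
  refine Finset.sum_congr rfl fun x _ => ?_
  dsimp only
  rw [← Finset.sum_mul, ← mul_assoc, two_mul_sum_collisions, mul_assoc]

end AntisymLift

/-! ### Bounds on the energy -/

section Bounds

variable {V : Type*} [Fintype V] [DecidableEq V] {N : ℕ}

theorem sub_smul_one_isHermitian {ι : Type*} [Fintype ι] [DecidableEq ι] {M : Matrix ι ι ℂ}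
    (hM : M.IsHermitian) (c : ℝ) : (M - (c : ℂ) • 1).IsHermitian :=
  hM.sub (Matrix.isHermitian_one.smul (by simp [IsSelfAdjoint]))

theorem sum_collisions_nonneg (f : (Fin N → V) → ℂ) :
    0 ≤ ∑ x, collisions x * ‖f x‖ ^ 2 :=
  Finset.sum_nonneg fun x _ => mul_nonneg (collisions_nonneg x) (by positivity)

theorem sum_collisions_le (f : (Fin N → V) → ℂ) :
    ∑ x, collisions x * ‖f x‖ ^ 2 ≤ (N : ℝ) ^ 2 * normSq f := by
  rw [normSq, Finset.mul_sum]
  exact Finset.sum_le_sum fun x _ => mul_le_mul_of_nonneg_right (collisions_le x) (by positivity)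

theorem quadForm_kinetic_nonneg {K : Matrix V V ℂ}
    (hK : K.IsHermitian) (hnonneg : ∀ x ∈ eigenvalues K, 0 ≤ x) (f : (Fin N → V) → ℂ) :
    0 ≤ quadForm (∑ i, onRegister N K i) f := by
  obtain ⟨Q, -, -, h⟩ := exists_proj_common_kernel hK hnonneg (g := 0) (fun x hx _ => hnonneg x hx) N
  simpa using h f

theorem groundEnergy_nonneg [Nonempty V]
    {A : Matrix V V ℂ} (hA : A.IsHermitian) {m : ℝ} (hm : minEigenvalue A = m)
    (hnonneg : ∀ x ∈ eigenvalues (A - (m : ℂ) • 1), 0 ≤ x) : 0 ≤ groundEnergy N A := by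
  obtain ⟨⟨⟨f, -, hf0, hf⟩, -⟩, -⟩ := groundEnergy_spec hA N
  have h := quadForm_of_mulVec_eq hf
  rw [hm, quadForm_hamiltonian_sub] at h
  have h1 := quadForm_kinetic_nonneg (sub_smul_one_isHermitian hA m) hnonneg f
  have h2 := sum_collisions_nonneg f
  exact nonneg_of_mul_nonneg_left (by linarith) (normSq_pos hf0)

theorem norm_sq_le_two_mul_add (a b : ℂ) : ‖a‖ ^ 2 ≤ 2 * ‖a - b‖ ^ 2 + 2 * ‖b‖ ^ 2 := by
  have h : ‖a‖ ≤ ‖a - b‖ + ‖b‖ := by simpa using norm_add_le (a - b) b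
  nlinarith [norm_nonneg a, sq_nonneg (‖a - b‖ - ‖b‖)]

end Bounds

/-! ### Comparison of the ground energies of a gate graph and its double -/

namespace GateDiagram

variable {R N : ℕ} {D : GateDiagram R}

theorem adjSL_sub_mulVec_antisymm (v : Vertex R → ℂ) (a : Vertex R × Fin 2) :
    (D.adjSL - (e1 : ℂ) • 1).mulVec (fun w => (-1) ^ (w.2 : ℕ) * v w.1) a =
      (-1) ^ (a.2 : ℕ) * (D.adj - (e1 : ℂ) • 1).mulVec v a.1 := by
  simp only [Matrix.sub_mulVec, Matrix.smul_mulVec, Matrix.one_mulVec, Pi.sub_apply, Pi.smul_apply,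
    smul_eq_mul]
  rw [show a = (a.1, a.2) from rfl, adjSL_mulVec_antisymm]
  ring

theorem onRegister_mulVec_antisymLift (φ : (Fin N → Vertex R) → ℂ) (i : Fin N) :
    (onRegister N (D.adjSL - (e1 : ℂ) • 1) i).mulVec (antisymLift φ) =
      antisymLift ((onRegister N (D.adj - (e1 : ℂ) • 1) i).mulVec φ) := by
  funext X
  rw [onRegister_mulVec, antisymLift, onRegister_mulVec,
    ← Finset.mul_prod_erase _ _ (Finset.mem_univ i)]
  simp only [antisymLift_update]
  have h := adjSL_sub_mulVec_antisymm (D := D)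
    (fun w => φ (Function.update (fun j => (X j).1) i w)) (X i)
  simp only [Matrix.mulVec, dotProduct] at h
  rw [mul_comm ((-1 : ℂ) ^ _), mul_assoc, ← h, Finset.mul_sum]
  exact Finset.sum_congr rfl fun a _ => by ring

theorem quadForm_kinetic_antisymLift (φ : (Fin N → Vertex R) → ℂ) :
    quadForm (∑ i, onRegister N (D.adjSL - (e1 : ℂ) • 1) i) (antisymLift φ) =
      2 ^ N * quadForm (∑ i, onRegister N (D.adj - (e1 : ℂ) • 1) i) φ := by
  rw [quadForm_sum, quadForm_sum, Finset.mul_sum]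
  refine Finset.sum_congr rfl fun i _ => ?_
  rw [quadForm, quadForm, onRegister_mulVec_antisymLift]
  set ψ := (onRegister N (D.adj - (e1 : ℂ) • 1) i).mulVec φ
  have h : ∀ X, star (antisymLift φ X) * antisymLift ψ X =
      star (φ fun i => (X i).1) * ψ fun i => (X i).1 := by
    intro X
    have h1 : star (∏ i, (-1 : ℂ) ^ ((X i).2 : ℕ)) * ∏ i, (-1 : ℂ) ^ ((X i).2 : ℕ) = 1 := by
      rw [RCLike.star_def, Complex.conj_mul', norm_sign]; simp
    rw [antisymLift, antisymLift, star_mul']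
    linear_combination (star (φ fun i => (X i).1) * ψ fun i => (X i).1) * h1
  simp only [dotProduct, Pi.star_apply, h]
  rw [sum_lift_const fun x => star (φ x) * ψ x, ← Nat.cast_smul_eq_nsmul ℝ]
  simp only [Complex.smul_re, smul_eq_mul]
  norm_num

/-- A state annihilated by every one-particle term of `G^SL` is antisymmetric in every second
register. -/
theorem exists_eq_antisymLift {u : (Fin N → Vertex R × Fin 2) → ℂ}
    (hu : ∀ i, (onRegister N (D.adjSL - (e1 : ℂ) • 1) i).mulVec u = 0)
    (hsymm : u ∈ bosonicSpace (Vertex R × Fin 2) N) :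
    ∃ φ ∈ bosonicSpace (Vertex R) N, u = antisymLift φ ∧
      ∀ i, (onRegister N (D.adj - (e1 : ℂ) • 1) i).mulVec φ = 0 := by
  -- With the other registers frozen, `u` satisfies the eigenvector equation of `D.adjSL` at `e1` in
  -- register `i`, which excludes the alternative `e1 + 1/256 ≤ e1`.
  have hker : ∀ i X, (∀ w, u (Function.update X i (w, 1)) = -u (Function.update X i (w, 0))) ∧
      D.adj.mulVec (fun w => u (Function.update X i (w, 0))) =
        (e1 : ℂ) • fun w => u (Function.update X i (w, 0)) := by
    intro i X
    have h1 : D.adjSL.mulVec (fun a => u (Function.update X i a)) =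
        (e1 : ℂ) • fun a => u (Function.update X i a) := by
      rw [← sub_eq_zero]
      funext a
      have h2 := congrFun (hu i) (Function.update X i a)
      rw [onRegister_mulVec] at h2
      simp only [Function.update_self, Function.update_idem] at h2
      rw [Pi.sub_apply]
      refine Eq.trans ?_ h2
      have h3 : ((D.adjSL - (e1 : ℂ) • 1).mulVec fun a => u (Function.update X i a)) a =
          ∑ b, (D.adjSL - (e1 : ℂ) • 1) a b * u (Function.update X i b) := rfl
      rw [← h3, Matrix.sub_mulVec, Matrix.smul_mulVec, Matrix.one_mulVec]
      rfl
    rcases eigenvector_adjSL h1 with h | h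
    · linarith
    · exact h
  refine ⟨fun x => u fun i => (x i, 0), ?_, ?_, fun i => ?_⟩
  · rw [mem_bosonicSpace_iff] at hsymm ⊢
    exact fun p x => hsymm p fun i => (x i, 0)
  · funext X
    -- The second registers are reset to `0` one at a time, each contributing its sign.
    have hind : ∀ s : Finset (Fin N), u X = (∏ i ∈ s, (-1) ^ ((X i).2 : ℕ)) *
        u fun i => if i ∈ s then ((X i).1, 0) else X i := by
      intro s
      induction s using Finset.induction_on with
      | empty => simp
      | insert i s hi ih =>
        rw [ih, Finset.prod_insert hi]
        set Y : Fin N → Vertex R × Fin 2 := fun i => if i ∈ s then ((X i).1, 0) else X i with hY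
        have h1 : (fun j => if j ∈ insert i s then ((X j).1, 0) else X j) =
            Function.update Y i ((X i).1, 0) := by
          funext j
          by_cases h : j = i
          · subst h; simp
          · simp [h, hY]
        have h2 : u Y = (-1) ^ ((X i).2 : ℕ) * u (Function.update Y i ((X i).1, 0)) := by
          have h3 : Y = Function.update Y i ((X i).1, (X i).2) := by
            rw [eq_comm, Function.update_eq_self_iff]; simp [hY, hi]
          conv_lhs => rw [h3]
          have h4 := (hker i Y).1 (X i).1
          rcases (X i).2 with ⟨d, hd⟩
          interval_cases d
          · simp
          · simpa using h4
        rw [h1, h2]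
        ring
    have := hind Finset.univ
    simpa [antisymLift] using this
  · funext x
    have h := congrFun (hker i fun i => (x i, 0)).2 (x i)
    rw [onRegister_mulVec]
    have h1 : ∀ w, (fun j => (Function.update x i w j, (0 : Fin 2))) =
        Function.update (fun j => (x j, (0 : Fin 2))) i (w, 0) := by
      intro w
      funext j
      by_cases h : j = i
      · subst h; simp
      · simp [Function.update_of_ne h]
    simp only [h1]
    have h3 : ((D.adj - (e1 : ℂ) • 1).mulVec fun w =>
        u (Function.update (fun j => (x j, (0 : Fin 2))) i (w, 0))) (x i) =
        ∑ b, (D.adj - (e1 : ℂ) • 1) (x i) b *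
          u (Function.update (fun j => (x j, (0 : Fin 2))) i (b, 0)) := rfl
    rw [← h3, Matrix.sub_mulVec, Matrix.smul_mulVec, Matrix.one_mulVec, Pi.sub_apply, h]
    simp

theorem IsE1GateGraph.nonempty_vertex (hD : D.IsE1GateGraph) : Nonempty (Vertex R) := by
  obtain ⟨v, -, hv0, -⟩ := hD.1
  obtain ⟨u, -⟩ := Function.ne_iff.mp hv0
  exact ⟨u⟩

/-- Doubling the graph does not raise the ground energy. -/
theorem IsE1GateGraph.groundEnergy_adjSL_le (hD : D.IsE1GateGraph) (N : ℕ) :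
    groundEnergy N D.adjSL ≤ groundEnergy N D.adj := by
  have := hD.nonempty_vertex
  obtain ⟨⟨⟨φ, hφ, hφ0, hφe⟩, -⟩, -⟩ := groundEnergy_spec D.adj_isHermitian N
  have h1 := quadForm_of_mulVec_eq hφe
  have h2 := (groundEnergy_spec D.adjSL_isHermitian N).2 _ (antisymLift_mem_bosonicSpace hφ)
  rw [hD.minEigenvalue_adj, quadForm_hamiltonian_sub] at h1
  rw [hD.minEigenvalue_adjSL, quadForm_hamiltonian_sub, normSq_antisymLift,
    quadForm_kinetic_antisymLift] at h2
  have h3 := two_mul_sum_collisions_antisymLift φ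
  have h4 := sum_collisions_nonneg φ
  have hpow : (0 : ℝ) < 2 ^ N := by positivity
  have hn : 0 < 2 ^ N * normSq φ := mul_pos hpow (normSq_pos hφ0)
  refine le_of_mul_le_mul_right ?_ hn
  have h5 : 0 ≤ 2 ^ N * ∑ x, collisions x * ‖φ x‖ ^ 2 := mul_nonneg hpow.le h4
  have h6 := congrArg (fun t => (2 : ℝ) ^ N * t) h1
  simp only [mul_add] at h6
  linarith

theorem IsE1GateGraph.groundEnergy_mul_normSq_le (hD : D.IsE1GateGraph)
    {φ : (Fin N → Vertex R) → ℂ} (hφ : φ ∈ bosonicSpace (Vertex R) N)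
    (hker : ∀ i, (onRegister N (D.adj - (e1 : ℂ) • 1) i).mulVec φ = 0) :
    groundEnergy N D.adj * normSq φ ≤ ∑ x, collisions x * ‖φ x‖ ^ 2 := by
  have := hD.nonempty_vertex
  have h := (groundEnergy_spec D.adj_isHermitian N).2 φ hφ
  rw [hD.minEigenvalue_adj, quadForm_hamiltonian_sub, quadForm_sum, Finset.sum_eq_zero, zero_add]
    at h
  · exact h
  · intro i _
    rw [quadForm, hker, dotProduct_zero, Complex.zero_re]

/-- The trial state `v ⊗ ⋯ ⊗ v`, with `v` an `e1`-eigenvector, has only interaction energy, and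
there are at most `N²` colliding pairs. -/
theorem IsE1GateGraph.groundEnergy_adj_le (hD : D.IsE1GateGraph) (N : ℕ) :
    groundEnergy N D.adj ≤ (N : ℝ) ^ 2 := by
  obtain ⟨v, -, hv0, hv⟩ := hD.1
  obtain ⟨a, ha⟩ := Function.ne_iff.mp hv0
  set φ : (Fin N → Vertex R) → ℂ := fun x => ∏ i, v (x i) with hφ
  have hφ0 : φ ≠ 0 := by
    intro h
    have := congrFun h fun _ => a
    simp only [hφ, Finset.prod_const, Pi.zero_apply] at this
    exact ha (eq_zero_of_pow_eq_zero this)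
  have hsymm : φ ∈ bosonicSpace (Vertex R) N := by
    rw [mem_bosonicSpace_iff]
    exact fun p x => Equiv.prod_comp p fun i => v (x i)
  have hker : ∀ i, (onRegister N (D.adj - (e1 : ℂ) • 1) i).mulVec φ = 0 := by
    intro i
    funext x
    rw [onRegister_mulVec]
    have h1 : ∀ b, φ (Function.update x i b) = v b * ∏ j ∈ Finset.univ.erase i, v (x j) := by
      intro b
      rw [hφ]
      simp only
      rw [← Finset.mul_prod_erase _ _ (Finset.mem_univ i), Function.update_self]
      congr 1
      exact Finset.prod_congr rfl fun j hj => by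
        rw [Function.update_of_ne (Finset.ne_of_mem_erase hj)]
    have h2 : (D.adj - (e1 : ℂ) • 1).mulVec v (x i) = 0 := by
      rw [Matrix.sub_mulVec, Matrix.smul_mulVec, Matrix.one_mulVec, hv]
      simp
    simp only [h1, ← mul_assoc, ← Finset.sum_mul]
    rw [Matrix.mulVec, dotProduct] at h2
    rw [h2, zero_mul]
    rfl
  exact le_of_mul_le_mul_right ((hD.groundEnergy_mul_normSq_le hsymm hker).trans
    (sum_collisions_le φ)) (normSq_pos hφ0)

/-- A state of low one-particle energy is close to the common kernel, where the interaction costs at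
least `b/2`; a state far from it pays through the gap. -/
theorem IsE1GateGraph.gap_mul_groundEnergy_le (hD : D.IsE1GateGraph) (hN : N ≠ 0) {b : ℝ}
    (hb : 0 ≤ b) (hbE : b ≤ groundEnergy N D.adj) :
    min (gap (D.adj - (e1 : ℂ) • 1)) (1 / 256) * b ≤
      10 * (N : ℝ) ^ 2 * groundEnergy N D.adjSL := by
  have := hD.nonempty_vertex
  set g := min (gap (D.adj - (e1 : ℂ) • 1)) (1 / 256) with hg
  have hg0 : 0 ≤ g := le_min (Real.sInf_nonneg fun x hx => hD.nonneg_of_mem_adj hx.1) (by norm_num)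
  have hg1 : g ≤ 1 := (min_le_right _ _).trans (by norm_num)
  have hN1 : (1 : ℝ) ≤ (N : ℝ) ^ 2 := by
    have : (1 : ℝ) ≤ N := by exact_mod_cast Nat.one_le_iff_ne_zero.mpr hN
    nlinarith
  have hbN : b ≤ (N : ℝ) ^ 2 := hbE.trans (hD.groundEnergy_adj_le N)
  obtain ⟨Q, hQsymm, hQker, hQgap⟩ := exists_proj_common_kernel
    (sub_smul_one_isHermitian D.adjSL_isHermitian e1) (fun _ hx => hD.nonneg_of_mem_adjSL hx)
    (fun _ hx hx0 => hD.min_gap_le hx hx0) N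
  obtain ⟨⟨⟨ψ, hψ, hψ0, hψe⟩, -⟩, -⟩ := groundEnergy_spec D.adjSL_isHermitian N
  have hE := quadForm_of_mulVec_eq hψe
  rw [hD.minEigenvalue_adjSL, quadForm_hamiltonian_sub] at hE
  set u := Q.mulVec ψ with hu
  set w := ψ - u with hw
  obtain ⟨φ, hφ, huφ, hφker⟩ := exists_eq_antisymLift (D := D) (u := u)
    (fun i => by rw [hu, Matrix.mulVec_mulVec, hQker, Matrix.zero_mulVec])
    (mulVec_mem_bosonicSpace hQsymm hψ)
  have hkin := hQgap ψ
  rw [← hu, ← hw, ← hg] at hkin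
  have hbu : b * normSq u ≤ 2 * ∑ X, collisions X * ‖u X‖ ^ 2 := by
    rw [huφ, two_mul_sum_collisions_antisymLift, normSq_antisymLift, mul_left_comm]
    refine mul_le_mul_of_nonneg_left ?_ (by positivity)
    exact (mul_le_mul_of_nonneg_right hbE (normSq_nonneg φ)).trans
      (hD.groundEnergy_mul_normSq_le hφ hφker)
  have hcoll : ∑ X, collisions X * ‖u X‖ ^ 2 ≤
      2 * ∑ X, collisions X * ‖ψ X‖ ^ 2 + 2 * ((N : ℝ) ^ 2 * normSq w) := by
    refine le_trans ?_ (add_le_add_right (mul_le_mul_of_nonneg_left (sum_collisions_le w)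
      (by norm_num : (0 : ℝ) ≤ 2)) _)
    rw [Finset.mul_sum, Finset.mul_sum, ← Finset.sum_add_distrib]
    refine Finset.sum_le_sum fun X _ => ?_
    have h1 := norm_sq_le_two_mul_add (u X) (-w X)
    rw [norm_neg, show u X - -w X = ψ X by simp [hw]] at h1
    nlinarith [mul_le_mul_of_nonneg_left h1 (collisions_nonneg X)]
  have hnorm : normSq ψ ≤ 2 * normSq w + 2 * normSq u := by
    simp only [normSq]
    rw [Finset.mul_sum, Finset.mul_sum, ← Finset.sum_add_distrib]
    exact Finset.sum_le_sum fun X _ => norm_sq_le_two_mul_add (ψ X) (u X)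
  have hw0 := normSq_nonneg w
  have hψn := normSq_pos hψ0
  set Ec := ∑ X, collisions X * ‖ψ X‖ ^ 2 with hEc
  have hEc0 : 0 ≤ Ec := sum_collisions_nonneg ψ
  set Ek := quadForm (∑ i, onRegister N (D.adjSL - (e1 : ℂ) • 1) i) ψ with hEk
  -- `hbu` and `hcoll` give `b‖u‖² ≤ 4 Ec + 4 N²‖w‖²`; `hnorm` doubles this and adds `2 b‖w‖² ≤ 2
  -- N²‖w‖²`.
  have h1 : b * normSq ψ ≤ 8 * Ec + 10 * ((N : ℝ) ^ 2 * normSq w) := by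
    have := mul_le_mul_of_nonneg_left hnorm hb
    have := mul_le_mul_of_nonneg_right hbN hw0
    linarith
  have h2 : g * (b * normSq ψ) ≤ 8 * (g * Ec) + 10 * ((N : ℝ) ^ 2 * (g * normSq w)) := by
    have := mul_le_mul_of_nonneg_left h1 hg0
    linarith
  -- Here `g ≤ 1 ≤ N²` puts the interaction term on the same scale as the one-particle term; this
  -- uses `N ≠ 0`.
  have h3 : g * Ec ≤ (N : ℝ) ^ 2 * Ec := mul_le_mul_of_nonneg_right (hg1.trans hN1) hEc0
  have h4 : (N : ℝ) ^ 2 * (g * normSq w) ≤ (N : ℝ) ^ 2 * Ek :=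
    mul_le_mul_of_nonneg_left hkin (by positivity)
  have h5 : 0 ≤ (N : ℝ) ^ 2 * Ec := mul_nonneg (by positivity) hEc0
  refine le_of_mul_le_mul_right ?_ hψn
  have h6 := congrArg (fun t => 10 * (N : ℝ) ^ 2 * t) hE
  simp only [mul_add] at h6
  linarith

end GateDiagram

end BoseHubbard

end

theorem mainTheorem4 :
    (∀ (R : ℕ) (D : BoseHubbard.GateDiagram R), D.IsE1GateGraph → ∀ (N : ℕ) (a : ℝ),
      BoseHubbard.groundEnergy N D.adj ≤ a →
        BoseHubbard.groundEnergy N D.adjSL ≤ 3 / 2 * a) ∧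
    ∃ C₁ : ℝ, 0 < C₁ ∧
      ∀ (R : ℕ) (D : BoseHubbard.GateDiagram R), D.IsE1GateGraph → ∀ (N : ℕ) (C₀ b : ℝ),
        BoseHubbard.gap (D.adj - (BoseHubbard.e1 : ℂ) • 1) ≥ C₀ / (R : ℝ) ^ 3 →
        BoseHubbard.groundEnergy N D.adj ≥ b → b > 0 →
          BoseHubbard.groundEnergy N D.adjSL ≥ C₀ * C₁ / ((R : ℝ) ^ 3 * (N : ℝ) ^ 2) * b := by
  refine ⟨fun R D hD N a ha => ?_, 1 / 358400, by norm_num, fun R D hD N C₀ b hgap hE hb => ?_⟩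
  · have := hD.nonempty_vertex
    -- Nonnegativity forces `0 ≤ a`, so the bound by `a` implies the bound by `3/2 * a`.
    have h0 := BoseHubbard.groundEnergy_nonneg (N := N) D.adj_isHermitian
      hD.minEigenvalue_adj fun _ hx => hD.nonneg_of_mem_adj hx
    linarith [hD.groundEnergy_adjSL_le N]
  · have := hD.nonempty_vertex
    have h0 := BoseHubbard.groundEnergy_nonneg (N := N) D.adjSL_isHermitian
      hD.minEigenvalue_adjSL fun _ hx => hD.nonneg_of_mem_adjSL hx
    -- For `N = 0` the right-hand side is a division by zero, with value `0`.
    by_cases hN : N = 0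
    · simpa [hN] using h0
    set γ := BoseHubbard.gap (D.adj - (BoseHubbard.e1 : ℂ) • 1) with hγ
    have hγ0 : 0 ≤ γ := Real.sInf_nonneg fun x hx => hD.nonneg_of_mem_adj hx.1
    have hγ1 : γ ≤ 140 := hD.gap_le_const
    -- `35840 = 140 * 256`, with `140` the bound on `γ`; the factor `10` from
    -- `gap_mul_groundEnergy_le` then gives `C₁ = 1 / 358400`.
    have hmin : γ / 35840 ≤ min γ (1 / 256) := le_min (by linarith) (by linarith)
    have h1 := hD.gap_mul_groundEnergy_le hN hb.le hE
    rw [← hγ] at h1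
    have hN2 : (0 : ℝ) < (N : ℝ) ^ 2 := by positivity
    have h2 : C₀ / (R : ℝ) ^ 3 / 35840 * b ≤ min γ (1 / 256) * b :=
      mul_le_mul_of_nonneg_right (by linarith) hb.le
    have h3 : C₀ * (1 / 358400) / ((R : ℝ) ^ 3 * (N : ℝ) ^ 2) * b =
        C₀ / (R : ℝ) ^ 3 / 35840 * b / (10 * (N : ℝ) ^ 2) := by
      rw [mul_comm ((R : ℝ) ^ 3), ← div_div, div_div _ _ ((R : ℝ) ^ 3)]
      ring
    rw [ge_iff_le, h3, div_le_iff₀ (by positivity)]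
    linarith
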